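/- For integers $k,n\ge 1$ and $0\le m\le\binom nk$, let $H_k(n,m)$ denote the uniform distribution on the set of all $k$-uniform hypergraphs with vertex set $[n]=\{1,\dots,n\}$ and exactly $m$ (distinct) edges. A vertex cover of a hypergraph is a set of vertices containing at least one vertex of every edge; a pair of hypergraphs on the same vertex set admits disjoint covers if there are a vertex cover of the first and a vertex cover of the second that are disjoint. Theorem. Fix $k\ge 3$. For $r\ge 0$ and all $n$ large enough that $\lfloor rn\rfloor\le\binom nk$, let $H_1,H_2$ be independent random hypergraphs, each distributed as $H_k(n,\lfloor rn\rfloor)$. (i) If $r>2^{k-1}\ln 2$, then $\Pr[H_1\text{ and }H_2\text{ admit no disjoint covers}]\to 1$ as $n\to\infty$. (ii) There is a constant $C=C(k)>0$, depending only on $k$, such that for every $r\ge 0$ with $r<2^{k-1}\ln 2-(k+1)\ln 2-1$, $$\Pr[H_1\text{ and }H_2\text{ admit disjoint covers}]>C\quad\text{for all sufficiently large }n.$$ -/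

import Mathlib

open Filter Topology MeasureTheory ProbabilityTheory

namespace DisjointCovers

/-- The set of all `k`-uniform hypergraphs with vertex set `[n]` and exactly `m` edges. -/
def uniformHypergraphs (k n m : ℕ) : Set (Hypergraph (Fin n)) :=
  {H | H.vertexSet = Set.univ ∧ (∀ e ∈ H.edgeSet, e.ncard = k) ∧ H.edgeSet.ncard = m}

/-- There are finitely many hypergraphs on a subset of `[n]`; every set of them is an event. -/
instance instMeasurableSpaceHypergraph (n : ℕ) : MeasurableSpace (Hypergraph (Fin n)) := ⊤

/-- The distribution `H_k(n, m)`: the uniform distribution on the `k`-uniform hypergraphs with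
vertex set `[n]` and exactly `m` edges (a probability measure whenever `m ≤ n.choose k`). -/
noncomputable def randomHypergraph (k n m : ℕ) : Measure (Hypergraph (Fin n)) :=
  uniformOn (uniformHypergraphs k n m)

/-- The law of a pair of independent hypergraphs, each distributed as `H_k(n, m)`. -/
noncomputable def randomPair (k n m : ℕ) : Measure (Hypergraph (Fin n) × Hypergraph (Fin n)) :=
  (randomHypergraph k n m).prod (randomHypergraph k n m)

/-- A vertex cover: a set of vertices that contains at least one vertex of every edge. -/
def IsVertexCover {V : Type*} (H : Hypergraph V) (A : Set V) : Prop :=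
  A ⊆ H.vertexSet ∧ ∀ e ∈ H.edgeSet, ∃ v ∈ e, v ∈ A

/-- The pair `H₁`, `H₂` admits disjoint covers: a vertex cover of `H₁` and a vertex cover of `H₂`
that are disjoint. -/
def AdmitDisjointCovers {V : Type*} (H₁ H₂ : Hypergraph V) : Prop :=
  ∃ A B : Set V, IsVertexCover H₁ A ∧ IsVertexCover H₂ B ∧ Disjoint A B

end DisjointCovers

/-!
Write `K = 2 ^ k - k - 1`. Since a cover may be enlarged, a pair of hypergraphs admits disjoint
covers iff one vertex set `A` meets every edge of the first and its complement meets every edge of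
the second (`Separable`), so the probability in question is a ratio of numbers of pairs of sets of
`m` edges (`randomPair_real_admitDisjointCovers`).

*Upper bound.* For fixed `A` the probability that `A` separates is at most
`exp (-m (p + q))`, where `p` and `q` are the proportions of `k`-sets inside `A` and inside its
complement; by convexity `p + q ≥ 2 ^ (1 - k) (1 - o(1))`. The union bound over the `2 ^ n` sets `A`
tends to zero as soon as `r > 2 ^ (k - 1) log 2` (`tendsto_separableFraction_zero`).

*Lower bound.* Replace the edges by `M` independent uniform `k`-tuples on `4 L` vertices, where
`n ≤ 4 L ≤ n + 3`, and apply the second moment method to a weighted number of balanced separating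
sets `A`, those with `#A = 2 L`. The plain count fails, because separating sets are attracted to a
common majority assignment. So a tuple with `j > 0` entries in `A` gets weight `1 - 2 ^ (1 - k) j`
and a tuple missing `A` gets weight `0` (`clauseWeight`); this is the indicator function of meeting
`A`, corrected by an affine function so that its Fourier coefficients of degree one vanish while it
still vanishes where the indicator does. Nonnegativity of the weights is irrelevant: a nonzero sum
of products has a nonzero term. Two balanced sets with correlation `x` then contribute, per tuple,
`1 + φ(x) / K ^ 2` relative to independence, where `φ(x) = (1 + x) ^ k - 1 - k x` is quadratically
small at `0` (`sum_clauseWeight_mul`). The ratio of the second moment to the squared first moment is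
therefore at most `∑ i, (2L choose i) ^ 2 (1 + φ(i / L - 1) / K ^ 2) ^ (2 M) / (4L choose 2L)`. For
`|x| ≤ 4 / 5` the Gaussian decay of the binomial coefficients beats `φ` (`rate_le_quadratic`), and
for larger `|x|` the entropy bound makes the terms exponentially small (`rate_lt_log_two`), which is
where the loss of `(k + 1) log 2 + 1` in the density is used. Hence the ratio is at most `157`
(`eventually_overlapSum_le`), and tuples are separable with probability at least `1 / 157`
(`card_tupleSeparable_ge`).

Finally the set of edges listed by the tuples is uniform given its size, and separability is
inherited by subsets, so by the local LYM inequality it is at least as likely for exactly `m` edges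
as for more (`card_sampled_pair_le`). With `M - m` linear in `n`, at least `m` distinct edges are
listed except with vanishing probability, since only boundedly many tuples are lost in expectation
(`card_sampled_lt_le`).
-/

namespace DisjointCovers

open Finset

/-! ### From random hypergraphs to counting -/

/-- The possible edges of a `k`-uniform hypergraph on `[n]`. -/
abbrev Edge (n k : ℕ) : Type := {e : Finset (Fin n) // #e = k}

/-- A single vertex set `A` meets every edge of `S` while its complement meets every edge of `T`.
For edge sets of hypergraphs this is the existence of disjoint covers, since the second cover may
be enlarged to the complement of the first one. -/
def Separable {n k : ℕ} (S T : Finset (Edge n k)) : Prop :=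
  ∃ A : Finset (Fin n), (∀ e ∈ S, ∃ v ∈ e.1, v ∈ A) ∧ ∀ e ∈ T, ∃ v ∈ e.1, v ∉ A

/-- The `k`-uniform hypergraph on `[n]` with edge set `S`. -/
def toHypergraph {n k : ℕ} (S : Finset (Edge n k)) : Hypergraph (Fin n) where
  vertexSet := Set.univ
  edgeSet := (fun e : Edge n k => (e.1 : Set (Fin n))) '' S
  subset_vertexSet_of_mem_edgeSet' _ _ := Set.subset_univ _

lemma coe_edge_injective {n k : ℕ} :
    Function.Injective (fun e : Edge n k => (e.1 : Set (Fin n))) :=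
  fun _ _ h => Subtype.ext (Finset.coe_injective h)

lemma toHypergraph_injective {n k : ℕ} :
    Function.Injective (toHypergraph : Finset (Edge n k) → Hypergraph (Fin n)) := by
  intro S T h
  have := congrArg Hypergraph.edgeSet h
  exact Finset.coe_injective (coe_edge_injective.image_injective this)

lemma card_edge (n k : ℕ) : Fintype.card (Edge n k) = n.choose k := by
  simp [Edge]

lemma uniformHypergraphs_eq_image (k n m : ℕ) :
    uniformHypergraphs k n m =
      toHypergraph '' (powersetCard m (univ : Finset (Edge n k)) : Set (Finset (Edge n k))) := by
  classical
  ext H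
  constructor
  · rintro ⟨hV, hE, hm⟩
    refine ⟨univ.filter fun e : Edge n k => (e.1 : Set (Fin n)) ∈ H.edgeSet, ?_, ?_⟩
    · have himg : (fun e : Edge n k => (e.1 : Set (Fin n))) ''
          (univ.filter fun e : Edge n k => (e.1 : Set (Fin n)) ∈ H.edgeSet) = H.edgeSet := by
        ext e
        constructor
        · rintro ⟨e, he, rfl⟩
          simpa using he
        · intro he
          refine ⟨⟨e.toFinset, ?_⟩, ?_, by simp⟩
          · rw [← Set.ncard_eq_toFinset_card', hE e he]
          · simpa using he
      rw [← himg, Set.ncard_image_of_injective _ coe_edge_injective, Set.ncard_coe_finset] at hm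
      simpa [mem_powersetCard] using hm
    · apply Hypergraph.ext
      · exact hV.symm
      · ext e
        constructor
        · rintro ⟨e, he, rfl⟩
          simpa using he
        · intro he
          refine ⟨⟨e.toFinset, ?_⟩, ?_, by simp⟩
          · rw [← Set.ncard_eq_toFinset_card', hE e he]
          · simpa using he
  · rintro ⟨S, hS, rfl⟩
    refine ⟨rfl, ?_, ?_⟩
    · rintro _ ⟨e, -, rfl⟩
      simpa using e.2
    · simp only [toHypergraph]
      rw [Set.ncard_image_of_injective _ coe_edge_injective, Set.ncard_coe_finset]
      simpa [mem_powersetCard] using hS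

lemma admitDisjointCovers_toHypergraph {n k : ℕ} (S T : Finset (Edge n k)) :
    AdmitDisjointCovers (toHypergraph S) (toHypergraph T) ↔ Separable S T := by
  classical
  constructor
  · rintro ⟨A, B, ⟨-, hA⟩, ⟨-, hB⟩, hAB⟩
    refine ⟨A.toFinset, fun e he => ?_, fun e he => ?_⟩
    · simpa using hA _ ⟨e, he, rfl⟩
    · obtain ⟨v, hv, hvB⟩ := hB _ ⟨e, he, rfl⟩
      exact ⟨v, by simpa using hv, fun h => Set.disjoint_left.1 hAB (by simpa using h) hvB⟩
  · rintro ⟨A, hA, hB⟩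
    refine ⟨A, (A : Set (Fin n))ᶜ, ⟨Set.subset_univ _, ?_⟩, ⟨Set.subset_univ _, ?_⟩,
      disjoint_compl_right⟩
    · rintro _ ⟨e, he, rfl⟩
      simpa using hA e he
    · rintro _ ⟨e, he, rfl⟩
      simpa using hB e he

instance (n : ℕ) : Finite (Hypergraph (Fin n)) :=
  Finite.of_injective (fun H : Hypergraph (Fin n) => (H.vertexSet, H.edgeSet)) fun _ _ h =>
    Hypergraph.ext (Prod.ext_iff.1 h).1 (Prod.ext_iff.1 h).2

instance (n : ℕ) : MeasurableSingletonClass (Hypergraph (Fin n)) := ⟨fun _ => trivial⟩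

lemma uniformOn_prod_real {Ω : Type*} [Finite Ω] [MeasurableSpace Ω] [MeasurableSingletonClass Ω]
    (s : Finset Ω) (D : Set (Ω × Ω)) [DecidablePred (· ∈ D)] :
    ((uniformOn (s : Set Ω)).prod (uniformOn (s : Set Ω))).real D =
      (#{p ∈ s ×ˢ s | p ∈ D} : ℝ) / (#s : ℝ) ^ 2 := by
  classical
  have := Fintype.ofFinite Ω
  have hsf : SFinite (uniformOn (s : Set Ω)) := by unfold uniformOn; infer_instance
  have hpt (p : Ω × Ω) : ((uniformOn (s : Set Ω)).prod (uniformOn (s : Set Ω))).real {p} =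
      if p ∈ s ×ˢ s then 1 / (#s : ℝ) ^ 2 else 0 := by
    obtain ⟨a, b⟩ := p
    have h1 (x : Ω) : (uniformOn (s : Set Ω)).real {x} = if x ∈ s then 1 / (#s : ℝ) else 0 := by
      rw [measureReal_def, ← Finset.coe_singleton, uniformOn_apply_finset]
      by_cases hx : x ∈ s <;> simp [hx]
    rw [← Set.singleton_prod_singleton, measureReal_prod_prod, h1, h1]
    by_cases ha : a ∈ s <;> by_cases hb : b ∈ s <;> simp [ha, hb, sq]
  have hD : D = ((univ.filter (· ∈ D) : Finset (Ω × Ω)) : Set (Ω × Ω)) := by ext; simp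
  have hfin : IsFiniteMeasure ((uniformOn (s : Set Ω)).prod (uniformOn (s : Set Ω))) := by
    have : IsFiniteMeasure (uniformOn (s : Set Ω)) := by unfold uniformOn; infer_instance
    infer_instance
  conv_lhs => rw [hD]
  rw [← sum_measureReal_singleton]
  simp only [hpt]
  rw [← Finset.sum_filter, Finset.sum_const, nsmul_eq_mul, mul_one_div]
  congr 3
  ext p
  simp [and_comm]

open Classical in
/-- The probability that two independent uniformly random sets of `m` edges are separable. -/
noncomputable def separableFraction (k n m : ℕ) : ℝ :=
  (#{p ∈ powersetCard m (univ : Finset (Edge n k)) ×ˢ powersetCard m univ | Separable p.1 p.2} : ℝ) /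
    ((n.choose k).choose m : ℝ) ^ 2

lemma randomPair_real_admitDisjointCovers (k n m : ℕ) :
    (randomPair k n m).real {H | AdmitDisjointCovers H.1 H.2} = separableFraction k n m := by
  classical
  have hs : uniformHypergraphs k n m = ((powersetCard m (univ : Finset (Edge n k))).map
      ⟨toHypergraph, toHypergraph_injective⟩ : Finset (Hypergraph (Fin n))) := by
    rw [uniformHypergraphs_eq_image]; simp
  rw [randomPair, randomHypergraph, hs, uniformOn_prod_real, separableFraction]
  simp only [card_map, card_powersetCard, card_univ, card_edge]
  congr 2
  symm
  refine card_bij (fun p _ => (toHypergraph p.1, toHypergraph p.2)) ?_ ?_ ?_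
  · rintro ⟨S, T⟩ h
    simpa [admitDisjointCovers_toHypergraph, toHypergraph_injective.eq_iff] using h
  · rintro ⟨S, T⟩ - ⟨S', T'⟩ - h
    simpa [toHypergraph_injective.eq_iff] using h
  · rintro ⟨H, H'⟩ h
    simp only [mem_filter, mem_product, Finset.mem_map, Function.Embedding.coeFn_mk,
      Set.mem_ofPred_eq] at h
    obtain ⟨⟨⟨S, hS, rfl⟩, T, hT, rfl⟩, hST⟩ := h
    exact ⟨(S, T), by simp_all [admitDisjointCovers_toHypergraph], rfl⟩

lemma randomPair_real_not_admitDisjointCovers {k n m : ℕ} (h : m ≤ n.choose k) :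
    (randomPair k n m).real {H | ¬ AdmitDisjointCovers H.1 H.2} = 1 - separableFraction k n m := by
  have hne : (uniformHypergraphs k n m).Nonempty := by
    rw [uniformHypergraphs_eq_image]
    refine Set.Nonempty.image _ ?_
    simpa [card_edge] using h
  have : IsProbabilityMeasure (randomHypergraph k n m) :=
    isProbabilityMeasure_uniformOn (Set.toFinite _) hne
  have : IsProbabilityMeasure (randomPair k n m) := by unfold randomPair; infer_instance
  rw [← randomPair_real_admitDisjointCovers,
    ← probReal_compl_eq_one_sub (Set.toFinite _).measurableSet]
  rfl

/-! ### The upper bound on the threshold: first moment -/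

/-- Sampling without replacement avoids a given set of `t - s` elements with at most the
probability it has when sampling with replacement. -/
lemma choose_div_choose_le_pow {s t : ℕ} (hst : s ≤ t) (m : ℕ) :
    (s.choose m : ℝ) / t.choose m ≤ ((s : ℝ) / t) ^ m := by
  rcases Nat.lt_or_ge t m with hm | hm
  · rw [Nat.choose_eq_zero_of_lt hm]
    simp only [Nat.cast_zero, div_zero]; positivity
  have key : ∀ m, m ≤ t → (s.descFactorial m : ℝ) * (t : ℝ) ^ m ≤
      t.descFactorial m * (s : ℝ) ^ m := by
    intro m
    induction m with
    | zero => simp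
    | succ m ih =>
      intro hm
      rcases Nat.lt_or_ge s (m + 1) with h | h
      · rw [Nat.descFactorial_eq_zero_iff_lt.2 h]; simp; positivity
      rw [Nat.descFactorial_succ, Nat.descFactorial_succ, pow_succ, pow_succ]
      push_cast [Nat.cast_sub (show m ≤ s by omega), Nat.cast_sub (show m ≤ t by omega)]
      have h1 := ih (by omega)
      have h2 : ((s : ℝ) - m) * t ≤ (t - m) * s := by
        have : (s : ℝ) ≤ t := by exact_mod_cast hst
        have h3 : (0 : ℝ) ≤ m := by positivity
        nlinarith
      have h4 : (0 : ℝ) ≤ (s - m) * t := by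
        have : (m : ℝ) ≤ s := by exact_mod_cast (show m ≤ s by omega)
        have : (0 : ℝ) ≤ s - m := by linarith
        positivity
      have h5 : (0 : ℝ) ≤ (t - m) * s := h4.trans h2
      calc _ = (((s : ℝ) - m) * t) * (s.descFactorial m * t ^ m) := by ring
        _ ≤ ((t - m) * s) * (t.descFactorial m * s ^ m) := by gcongr
        _ = _ := by ring
  rcases Nat.eq_zero_or_pos t with rfl | ht
  · obtain rfl : m = 0 := by omega
    simp
  have h := key m hm
  rw [Nat.descFactorial_eq_factorial_mul_choose, Nat.descFactorial_eq_factorial_mul_choose] at h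
  push_cast at h
  have hf : (0 : ℝ) < (m.factorial : ℝ) := by exact_mod_cast m.factorial_pos
  have hc : (0 : ℝ) < (t.choose m : ℝ) := by exact_mod_cast Nat.choose_pos hm
  rw [div_pow, div_le_div_iff₀ hc (by positivity)]
  refine le_of_mul_le_mul_left ?_ hf
  linarith

/-- Power mean inequality for binomial coefficients: whatever the size of `A`, at least about a
`2^{1-k}` proportion of the `k`-sets is contained in `A` or in its complement. -/
lemma two_mul_pow_le_choose_add_choose {n k a : ℕ} (hk1 : 1 ≤ k) (hk : 2 * k - 2 ≤ n)
    (ha : a ≤ n) :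
    (2 : ℝ) * (((n : ℝ) + 2 - 2 * k) / 2) ^ k ≤
      k.factorial * ((a.choose k : ℝ) + (n - a).choose k) := by
  have h (b : ℕ) : (((b + 1 - k : ℕ) : ℝ)) ^ k ≤ k.factorial * (b.choose k : ℝ) := by
    have := Nat.pow_sub_le_descFactorial b k
    rw [Nat.descFactorial_eq_factorial_mul_choose] at this
    exact_mod_cast this
  have hx : (0 : ℝ) ≤ ((a + 1 - k : ℕ) : ℝ) := by positivity
  have hy : (0 : ℝ) ≤ ((n - a + 1 - k : ℕ) : ℝ) := by positivity
  have hpm := add_pow_le hx hy k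
  have hsum : (n : ℝ) + 2 - 2 * k ≤ ((a + 1 - k : ℕ) : ℝ) + ((n - a + 1 - k : ℕ) : ℝ) := by
    have h1 : n + 2 ≤ (a + 1 - k) + (n - a + 1 - k) + 2 * k := by omega
    have h2 : ((n + 2 : ℕ) : ℝ) ≤ (((a + 1 - k) + (n - a + 1 - k) + 2 * k : ℕ) : ℝ) := by
      exact_mod_cast h1
    push_cast at h2
    linarith
  have h0 : (0 : ℝ) ≤ (n : ℝ) + 2 - 2 * k := by
    have : 2 * k ≤ n + 2 := by omega
    have : ((2 * k : ℕ) : ℝ) ≤ ((n + 2 : ℕ) : ℝ) := by exact_mod_cast this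
    push_cast at this
    linarith
  obtain ⟨j, rfl⟩ : ∃ j, k = j + 1 := ⟨k - 1, by omega⟩
  have h3 := (pow_le_pow_left₀ h0 hsum (j + 1)).trans hpm
  rw [Nat.add_sub_cancel] at h3
  rw [div_pow, pow_succ 2 j, mul_div_assoc', div_le_iff₀ (by positivity)]
  calc (2 : ℝ) * ((n : ℝ) + 2 - 2 * (j + 1 : ℕ)) ^ (j + 1)
      ≤ 2 * (2 ^ j * (((a + 1 - (j + 1) : ℕ) : ℝ) ^ (j + 1) +
          ((n - a + 1 - (j + 1) : ℕ) : ℝ) ^ (j + 1))) := by gcongr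
    _ ≤ 2 * (2 ^ j * ((j + 1).factorial * (a.choose (j + 1) : ℝ) +
          (j + 1).factorial * ((n - a).choose (j + 1) : ℝ))) := by
        gcongr
        · exact h a
        · exact h (n - a)
    _ = _ := by ring

open Classical in
lemma card_edge_not_meeting {n k : ℕ} (A : Finset (Fin n)) :
    #{e : Edge n k | ¬ ∃ v ∈ e.1, v ∈ A} = (n - #A).choose k := by
  have : #(powersetCard k Aᶜ) = (n - #A).choose k := by
    rw [card_powersetCard, card_compl, Fintype.card_fin]
  rw [← this, ← card_map (Function.Embedding.subtype _)]
  congr 1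
  ext e
  simp only [Finset.mem_map, mem_filter, mem_univ, true_and, Function.Embedding.subtype_apply,
    Subtype.exists, mem_powersetCard, exists_and_right, exists_eq_right]
  constructor
  · rintro ⟨h, h'⟩
    exact ⟨fun v hv => mem_compl.2 fun hA => h' ⟨v, hv, hA⟩, h⟩
  · rintro ⟨h, h'⟩
    exact ⟨h', fun ⟨v, hv, hA⟩ => mem_compl.1 (h hv) hA⟩

open Classical in
/-- The proportion of the sets of `m` edges all of which meet `A`. -/
lemma fraction_meeting_le {n k : ℕ} (m : ℕ) (hk : k ≤ n) (A : Finset (Fin n)) :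
    (#{S ∈ powersetCard m (univ : Finset (Edge n k)) | ∀ e ∈ S, ∃ v ∈ e.1, v ∈ A} : ℝ) /
      (n.choose k).choose m ≤ Real.exp (-(m * ((n - #A).choose k / n.choose k))) := by
  set t := n.choose k with ht
  have htpos : 0 < t := Nat.choose_pos hk
  have hcard : #{S ∈ powersetCard m (univ : Finset (Edge n k)) | ∀ e ∈ S, ∃ v ∈ e.1, v ∈ A} =
      (t - (n - #A).choose k).choose m := by
    have h1 : #{e : Edge n k | ∃ v ∈ e.1, v ∈ A} = t - (n - #A).choose k := by
      have h2 := card_filter_add_card_filter_not (s := (univ : Finset (Edge n k)))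
        (fun e => ∃ v ∈ e.1, v ∈ A)
      rw [card_edge_not_meeting, card_univ, card_edge] at h2
      omega
    rw [← h1, ← card_powersetCard]
    congr 1
    ext S
    simp only [mem_filter, mem_powersetCard, true_and, Finset.subset_iff, mem_univ,
      implies_true]
    exact and_comm
  rw [hcard]
  have hle : (n - #A).choose k ≤ t := Nat.choose_le_choose k (Nat.sub_le _ _)
  refine (choose_div_choose_le_pow (Nat.sub_le _ _) m).trans ?_
  have htr : (0 : ℝ) < t := by exact_mod_cast htpos
  have h1 : ((t - (n - #A).choose k : ℕ) : ℝ) / t ≤ Real.exp (-((n - #A).choose k / t)) := by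
    rw [Nat.cast_sub hle, sub_div, div_self htr.ne']
    have := Real.add_one_le_exp (-(((n - #A).choose k : ℝ) / t))
    linarith
  calc _ ≤ (Real.exp (-((n - #A).choose k / t))) ^ m := by gcongr
    _ = _ := by rw [← Real.exp_nat_mul]; ring_nf

/-- Union bound over the `2^n` candidates for the first cover. -/
lemma separableFraction_le_exp {n k : ℕ} (m : ℕ) (hk1 : 1 ≤ k) (hk : 2 * k ≤ n) :
    separableFraction k n m ≤
      Real.exp (n * Real.log 2 - m * (2 * (((n : ℝ) + 2 - 2 * k) / (2 * n)) ^ k)) := by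
  classical
  set F : Finset (Finset (Edge n k)) := powersetCard m univ with hF
  set c : ℝ := 2 * (((n : ℝ) + 2 - 2 * k) / (2 * n)) ^ k with hc
  have hcover : (#{p ∈ F ×ˢ F | Separable p.1 p.2} : ℝ) ≤
      ∑ A : Finset (Fin n), (#{S ∈ F | ∀ e ∈ S, ∃ v ∈ e.1, v ∈ A} : ℝ) *
        #{S ∈ F | ∀ e ∈ S, ∃ v ∈ e.1, v ∈ Aᶜ} := by
    have : {p ∈ F ×ˢ F | Separable p.1 p.2} ⊆
        (univ : Finset (Finset (Fin n))).biUnion fun A =>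
          {S ∈ F | ∀ e ∈ S, ∃ v ∈ e.1, v ∈ A} ×ˢ {S ∈ F | ∀ e ∈ S, ∃ v ∈ e.1, v ∈ Aᶜ} := by
      rintro ⟨S, T⟩ h
      simp only [mem_filter, mem_product] at h
      obtain ⟨⟨hS, hT⟩, A, hA, hB⟩ := h
      simp only [mem_biUnion, mem_univ, true_and, mem_product, mem_filter, mem_compl]
      exact ⟨A, ⟨hS, hA⟩, hT, hB⟩
    have h2 := (card_le_card this).trans card_biUnion_le
    simp only [card_product] at h2
    exact_mod_cast h2
  have hn : (0 : ℝ) < n := by exact_mod_cast (by omega : 0 < n)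
  have hterm (A : Finset (Fin n)) : (#{S ∈ F | ∀ e ∈ S, ∃ v ∈ e.1, v ∈ A} : ℝ) *
      #{S ∈ F | ∀ e ∈ S, ∃ v ∈ e.1, v ∈ Aᶜ} / ((n.choose k).choose m : ℝ) ^ 2 ≤
        Real.exp (-(m * c)) := by
    have h1 := fraction_meeting_le m (by omega : k ≤ n) A
    have h2 := fraction_meeting_le m (by omega : k ≤ n) Aᶜ
    have hA : #A ≤ n := by simpa using card_le_univ A
    rw [card_compl, Fintype.card_fin, Nat.sub_sub_self hA] at h2
    have h3 := two_mul_pow_le_choose_add_choose hk1 (by omega) hA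
    have h4 : (k.factorial : ℝ) * n.choose k ≤ (n : ℝ) ^ k := by
      have := Nat.descFactorial_le_pow n k
      rw [Nat.descFactorial_eq_factorial_mul_choose] at this
      exact_mod_cast this
    have ht : (0 : ℝ) < n.choose k := by exact_mod_cast Nat.choose_pos (by omega : k ≤ n)
    have hf : (0 : ℝ) < k.factorial := by exact_mod_cast k.factorial_pos
    have h5 : c ≤ ((#A).choose k + (n - #A).choose k) / (n.choose k : ℝ) := by
      rw [le_div_iff₀ ht]
      refine le_of_mul_le_mul_left ?_ hf
      have h0 : (0 : ℝ) ≤ c := by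
        have : (0 : ℝ) ≤ (n : ℝ) + 2 - 2 * k := by
          have : ((2 * k : ℕ) : ℝ) ≤ n := by exact_mod_cast hk
          push_cast at this
          linarith
        positivity
      calc (k.factorial : ℝ) * (c * n.choose k) = c * (k.factorial * n.choose k) := by ring
        _ ≤ c * (n : ℝ) ^ k := by gcongr
        _ = 2 * (((n : ℝ) + 2 - 2 * k) / 2) ^ k := by
          rw [hc, mul_assoc, ← mul_pow]
          congr 2
          field_simp
        _ ≤ _ := h3
    rw [sq, mul_div_mul_comm]
    calc _ ≤ Real.exp (-(m * ((n - #A).choose k / n.choose k))) *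
          Real.exp (-(m * ((#A).choose k / n.choose k))) := by gcongr
      _ = Real.exp (-(m * (((#A).choose k + (n - #A).choose k) / (n.choose k : ℝ)))) := by
        rw [← Real.exp_add]; ring_nf
      _ ≤ _ := by gcongr
  calc separableFraction k n m ≤ (∑ A : Finset (Fin n),
        (#{S ∈ F | ∀ e ∈ S, ∃ v ∈ e.1, v ∈ A} : ℝ) *
        #{S ∈ F | ∀ e ∈ S, ∃ v ∈ e.1, v ∈ Aᶜ}) / ((n.choose k).choose m : ℝ) ^ 2 := by
        unfold separableFraction
        gcongr
    _ ≤ ∑ _A : Finset (Fin n), Real.exp (-(m * c)) := by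
        rw [sum_div]; exact sum_le_sum fun A _ => hterm A
    _ = Real.exp (n * Real.log 2 - m * c) := by
        rw [sum_const, card_univ, Fintype.card_finset, Fintype.card_fin, nsmul_eq_mul, sub_eq_add_neg,
          Real.exp_add, Real.exp_nat_mul, Real.exp_log two_pos]
        push_cast; rfl

lemma tendsto_separableFraction_zero {k : ℕ} (hk : 1 ≤ k) {r : ℝ}
    (hr : 2 ^ (k - 1) * Real.log 2 < r) :
    Tendsto (fun n : ℕ => separableFraction k n ⌊r * n⌋₊) atTop (𝓝 0) := by
  have hlog := Real.log_pos one_lt_two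
  have hr0 : 0 < r := lt_of_le_of_lt (by positivity) hr
  have hm : Tendsto (fun n : ℕ => (⌊r * n⌋₊ : ℝ) / n) atTop (𝓝 r) :=
    (tendsto_nat_floor_mul_div_atTop hr0.le).comp tendsto_natCast_atTop_atTop
  have hb : Tendsto (fun n : ℕ => ((n : ℝ) + 2 - 2 * k) / (2 * n)) atTop (𝓝 (1 / 2)) := by
    have h1 : Tendsto (fun n : ℕ => 1 / 2 + (1 - k : ℝ) / n) atTop (𝓝 (1 / 2 + 0)) :=
      tendsto_const_nhds.add (tendsto_const_div_atTop_nhds_zero_nat _)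
    rw [add_zero] at h1
    refine h1.congr' ?_
    filter_upwards [eventually_gt_atTop 0] with n hn
    have : (n : ℝ) ≠ 0 := by exact_mod_cast hn.ne'
    field_simp
    ring
  have hlim : Tendsto (fun n : ℕ => Real.log 2 -
      (⌊r * n⌋₊ : ℝ) / n * (2 * (((n : ℝ) + 2 - 2 * k) / (2 * n)) ^ k)) atTop
      (𝓝 (Real.log 2 - r * (2 * (1 / 2) ^ k))) :=
    tendsto_const_nhds.sub (hm.mul ((hb.pow k).const_mul 2))
  have hneg : Real.log 2 - r * (2 * (1 / 2) ^ k) < 0 := by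
    obtain ⟨j, rfl⟩ : ∃ j, k = j + 1 := ⟨k - 1, by omega⟩
    rw [Nat.add_sub_cancel] at hr
    have : (2 : ℝ) * (1 / 2) ^ (j + 1) = (2 ^ j)⁻¹ := by
      rw [pow_succ, one_div, inv_pow]; ring
    rw [this, sub_neg, ← div_eq_mul_inv, lt_div_iff₀ (by positivity)]
    linarith
  have hbot := Tendsto.atTop_mul_neg hneg tendsto_natCast_atTop_atTop hlim
  refine squeeze_zero' (.of_forall fun n => ?_) ?_ (Real.tendsto_exp_atBot.comp hbot)
  · unfold separableFraction; positivity
  filter_upwards [eventually_ge_atTop (2 * k), eventually_gt_atTop 0] with n hn hn0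
  refine (separableFraction_le_exp _ hk hn).trans (le_of_eq ?_)
  have : (n : ℝ) ≠ 0 := by exact_mod_cast hn0.ne'
  simp only [Function.comp]
  congr 1
  field_simp

/-- For `k ≥ 2` linearly many edges are eventually available. -/
lemma eventually_floor_le_choose {k : ℕ} (hk : 2 ≤ k) (r : ℝ) :
    ∀ᶠ n : ℕ in atTop, ⌊r * n⌋₊ ≤ n.choose k := by
  filter_upwards [eventually_ge_atTop (2 * k), eventually_ge_atTop ⌈4 * r * k.factorial⌉₊]
    with n hn hn2
  refine Nat.floor_le_of_le ?_
  have hf : (0 : ℝ) < k.factorial := by exact_mod_cast k.factorial_pos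
  have h1 : 4 * r * k.factorial ≤ n := Nat.ceil_le.1 hn2
  have h2 : (((n + 1 - k : ℕ) : ℝ)) ^ k ≤ k.factorial * (n.choose k : ℝ) := by
    have := Nat.pow_sub_le_descFactorial n k
    rw [Nat.descFactorial_eq_factorial_mul_choose] at this
    exact_mod_cast this
  have h3 : (n : ℝ) / 2 ≤ ((n + 1 - k : ℕ) : ℝ) := by
    have : n ≤ 2 * (n + 1 - k) := by omega
    have : (n : ℝ) ≤ ((2 * (n + 1 - k) : ℕ) : ℝ) := by exact_mod_cast this
    push_cast at this
    linarith
  have h4 : (1 : ℝ) ≤ ((n + 1 - k : ℕ) : ℝ) := by exact_mod_cast (by omega : 1 ≤ n + 1 - k)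
  have h5 : ((n : ℝ) / 2) ^ 2 ≤ (((n + 1 - k : ℕ) : ℝ)) ^ k :=
    (pow_le_pow_left₀ (by positivity) h3 2).trans (pow_le_pow_right₀ h4 hk)
  refine le_of_mul_le_mul_left ?_ hf
  have h6 : (0 : ℝ) ≤ n := by positivity
  nlinarith

/-! ### Analytic inequalities for the overlap function -/

/-- The sum `∑ j ≥ 2, (k choose j) x ^ j`: the part of the binomial expansion of `(1 + x) ^ k` of
degree at least two. -/
def binomTail (k : ℕ) (x : ℝ) : ℝ := (1 + x) ^ k - 1 - k * x

lemma binomTail_succ (k : ℕ) (x : ℝ) :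
    binomTail (k + 1) x = (1 + x) * binomTail k x + k * x ^ 2 := by
  simp only [binomTail]; push_cast; ring

lemma binomTail_nonneg (k : ℕ) {x : ℝ} (hx : -1 ≤ x) : 0 ≤ binomTail k x := by
  have := one_add_mul_le_pow (by linarith : (-2 : ℝ) ≤ x) k
  simp only [binomTail]; linarith

/-- All coefficients are nonnegative, so negative arguments are dominated by positive ones. -/
lemma binomTail_le_binomTail_abs (k : ℕ) {x : ℝ} (hx : -1 ≤ x) :
    binomTail k x ≤ binomTail k |x| := by
  induction k with
  | zero => simp [binomTail]
  | succ k ih =>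
    rw [binomTail_succ, binomTail_succ, sq_abs]
    have h0 := binomTail_nonneg k hx
    have h1 : 0 ≤ 1 + x := by linarith
    have h2 := le_abs_self x
    gcongr

/-- `binomTail k x / x ^ 2` is monotone. -/
lemma sq_mul_binomTail_le (k : ℕ) {x y : ℝ} (hx : 0 ≤ x) (hxy : x ≤ y) :
    y ^ 2 * binomTail k x ≤ x ^ 2 * binomTail k y := by
  induction k with
  | zero => simp [binomTail]
  | succ k ih =>
    rw [binomTail_succ, binomTail_succ]
    have h0 := binomTail_nonneg k (by linarith : -1 ≤ x)
    have h1 : 0 ≤ 1 + y := by linarith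
    calc y ^ 2 * ((1 + x) * binomTail k x + k * x ^ 2)
        = (1 + x) * (y ^ 2 * binomTail k x) + k * x ^ 2 * y ^ 2 := by ring
      _ ≤ (1 + y) * (x ^ 2 * binomTail k y) + k * x ^ 2 * y ^ 2 := by gcongr
      _ = _ := by ring

lemma succ_mul_one_sub_pow_le {k : ℕ} (hk : 1 ≤ k) {b : ℝ} (hb : 0 ≤ b) (hb2 : b ≤ 1 / 2) :
    (k + 1) * (1 - b) ^ k ≤ 1 + k - 2 * k * b := by
  induction k, hk using Nat.le_induction with
  | base => norm_num; linarith
  | succ k hk ih =>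
    have hk0 : (0 : ℝ) ≤ k := by positivity
    have h1 : ((k : ℝ) + 1) * (((k + 1 : ℕ) + 1) * (1 - b) ^ (k + 1)) ≤
        (k + 1) * (1 + (k + 1 : ℕ) - 2 * (k + 1 : ℕ) * b) := by
      push_cast
      calc ((k : ℝ) + 1) * ((k + 1 + 1) * (1 - b) ^ (k + 1))
          = (k + 2) * (1 - b) * ((k + 1) * (1 - b) ^ k) := by ring
        _ ≤ (k + 2) * (1 - b) * (1 + k - 2 * k * b) := by
          have : 0 ≤ 1 - b := by linarith
          gcongr
        _ ≤ _ := by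
          have : 0 ≤ k * b := by positivity
          have h3 : 0 ≤ k * b * (k + 2) * (1 - 2 * b) := by
            have : 0 ≤ 1 - 2 * b := by linarith
            positivity
          nlinarith
    exact le_of_mul_le_mul_left h1 (by positivity)

lemma binomTail_one_sub_two_mul_le {k : ℕ} (hk : 1 ≤ k) {b : ℝ} (hb : 0 ≤ b) (hb2 : b ≤ 1 / 2) :
    binomTail k (1 - 2 * b) ≤ binomTail k 1 * (1 - b) ^ k := by
  have h := succ_mul_one_sub_pow_le hk hb hb2
  have h2 : (1 + (1 - 2 * b)) ^ k = 2 ^ k * (1 - b) ^ k := by rw [← mul_pow]; ring_nf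
  simp only [binomTail, h2]
  norm_num
  linarith

lemma one_sub_pow_le_quadratic (k : ℕ) {b : ℝ} (hb : 0 ≤ b) (hb1 : b ≤ 1) :
    (1 - b) ^ k ≤ 1 - k * b + k ^ 2 * b ^ 2 / 2 := by
  have h : (1 - b) ^ k ≤ 1 - k * b + k * (k - 1) / 2 * b ^ 2 := by
    induction k with
    | zero => simp
    | succ k ih =>
      have h1 : 0 ≤ 1 - b := by linarith
      have h2 : (0 : ℝ) ≤ k * (k - 1) / 2 * b ^ 2 * b := by
        rcases k with - | k
        · simp
        · push_cast; simp only [add_sub_cancel_right]; positivity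
      calc (1 - b) ^ (k + 1) = (1 - b) * (1 - b) ^ k := by ring
        _ ≤ (1 - b) * (1 - k * b + k * (k - 1) / 2 * b ^ 2) := by gcongr
        _ ≤ _ := by push_cast; nlinarith
  have : 0 ≤ k * b ^ 2 := by positivity
  nlinarith

/-- A tangent line to the concave function `b (1 - log b)`, which dominates the binary entropy. -/
lemma binEntropy_le_tangent {b s : ℝ} (hb : 0 ≤ b) (hb1 : b < 1) :
    Real.binEntropy b ≤ b * s + Real.exp (-s) := by
  rcases hb.eq_or_lt with rfl | hb
  · simp [Real.exp_nonneg]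
  have h1 : Real.log b⁻¹ ≤ s + (Real.exp (-s) / b - 1) := by
    have h := Real.log_le_sub_one_of_pos (show 0 < Real.exp (-s) / b by positivity)
    rw [Real.log_div (Real.exp_ne_zero _) hb.ne', Real.log_exp] at h
    rw [Real.log_inv]; linarith
  have h2 : Real.log (1 - b)⁻¹ ≤ (1 - b)⁻¹ - 1 := by
    have : 0 < 1 - b := by linarith
    exact Real.log_le_sub_one_of_pos (by positivity)
  have h3 : 0 < 1 - b := by linarith
  have h4 : b * Real.log b⁻¹ ≤ b * (s + (Real.exp (-s) / b - 1)) := by gcongr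
  have h5 : (1 - b) * Real.log (1 - b)⁻¹ ≤ (1 - b) * ((1 - b)⁻¹ - 1) := by gcongr
  have h6 : b * (s + (Real.exp (-s) / b - 1)) = b * s + Real.exp (-s) - b := by field_simp; ring
  have h7 : (1 - b) * ((1 - b)⁻¹ - 1) = b := by field_simp; ring
  rw [Real.binEntropy]; linarith

lemma binEntropy_le_log_two_mul {b : ℝ} (hb : 0 ≤ b) (hb1 : b < 1) (j : ℕ) :
    Real.binEntropy b ≤ b * (j * Real.log 2) + (1 / 2) ^ j := by
  refine (binEntropy_le_tangent hb hb1 (s := j * Real.log 2)).trans_eq ?_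
  rw [← mul_neg, Real.exp_nat_mul, Real.exp_neg, Real.exp_log two_pos]
  norm_num

/-- Twice the bound on the edge density in the lower bound on the threshold. -/
noncomputable def densityBound (k : ℕ) : ℝ :=
  2 * (2 ^ (k - 1) * Real.log 2 - (k + 1) * Real.log 2 - 1)

lemma densityBound_eq {k : ℕ} (hk : 1 ≤ k) :
    densityBound k = (binomTail k 1 - (k + 1)) * Real.log 2 - 2 := by
  obtain ⟨j, rfl⟩ : ∃ j, k = j + 1 := ⟨k - 1, by omega⟩
  simp only [densityBound, binomTail, Nat.add_sub_cancel]
  norm_num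
  ring

lemma three_mul_add_four_le_two_pow {k : ℕ} (hk : 4 ≤ k) : (3 : ℝ) * k + 4 ≤ 2 ^ k := by
  induction k, hk using Nat.le_induction with
  | base => norm_num
  | succ k hk ih =>
    have : (4 : ℝ) ≤ k := by exact_mod_cast hk
    push_cast; rw [pow_succ]; linarith

lemma binomTail_one (k : ℕ) : binomTail k 1 = 2 ^ k - 1 - k := by
  simp only [binomTail]; norm_num

lemma binomTail_one_pos {k : ℕ} (hk : 4 ≤ k) : 0 < binomTail k 1 := by
  have := three_mul_add_four_le_two_pow hk
  have h : (0 : ℝ) ≤ k := by positivity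
  rw [binomTail_one]; linarith

lemma densityBound_pos {k : ℕ} (hk : 4 ≤ k) : 0 < densityBound k := by
  have h := three_mul_add_four_le_two_pow hk
  have h4 : (4 : ℝ) ≤ k := by exact_mod_cast hk
  have := Real.log_two_gt_d9
  rw [densityBound_eq (by omega), binomTail_one]
  nlinarith

lemma densityBound_mul_binomTail_le {k : ℕ} (hk : 4 ≤ k) {b : ℝ} (hb : 0 ≤ b) (hb2 : b ≤ 1 / 2) :
    densityBound k * binomTail k (1 - 2 * b) / binomTail k 1 ^ 2 ≤
      densityBound k / binomTail k 1 * (1 - b) ^ k := by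
  have hK := binomTail_one_pos hk
  have hR := densityBound_pos hk
  calc _ ≤ densityBound k * (binomTail k 1 * (1 - b) ^ k) / binomTail k 1 ^ 2 := by
        gcongr; exact binomTail_one_sub_two_mul_le (by omega) hb hb2
    _ = _ := by field_simp

/-- The number `6.85` is a lower bound for `(k + 1) log 2 + 2` when `k ≥ 6`. -/
lemma densityBound_div_le {k : ℕ} (hk : 6 ≤ k) :
    densityBound k / binomTail k 1 ≤ Real.log 2 - 6.85 * (1 / 2) ^ k := by
  have hK := binomTail_one_pos (by omega : 4 ≤ k)
  have h6 : (6 : ℝ) ≤ k := by exact_mod_cast hk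
  have hl := Real.log_two_gt_d9
  have h1 : binomTail k 1 * (1 / 2) ^ k ≤ 1 := by
    have h2 : (2 : ℝ) ^ k * (1 / 2) ^ k = 1 := by rw [← mul_pow]; norm_num
    have : (0 : ℝ) ≤ k * (1 / 2) ^ k := by positivity
    have : (0 : ℝ) ≤ (1 / 2) ^ k := by positivity
    rw [binomTail_one, sub_mul, sub_mul, h2]
    linarith
  rw [div_le_iff₀ hK, densityBound_eq (by omega)]
  nlinarith

set_option maxHeartbeats 1000000 in
/-- The exponential rate of the second moment is negative when the overlap is far from one half:
here `1 - b` is the proportion of vertices on which two balanced sets agree. The tail is bounded by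
`(1 - b) ^ k` and the entropy by tangents of `b (1 - log b)`, mostly of slope `j log 2`; which
tangent works depends on the size of `b k` and `b k ^ 2`. -/
lemma rate_lt_log_two {k : ℕ} (hk : 4 ≤ k) {b : ℝ} (hb : 0 ≤ b) (hb2 : b ≤ 1 / 10) :
    densityBound k * binomTail k (1 - 2 * b) / binomTail k 1 ^ 2 + Real.binEntropy b <
      Real.log 2 := by
  have hK := binomTail_one_pos hk
  have hl := Real.log_two_gt_d9
  have hl2 := Real.log_two_lt_d9
  have hmain := densityBound_mul_binomTail_le hk hb (by linarith)
  set Q := densityBound k / binomTail k 1 with hQ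
  set Y := (1 - b) ^ k with hY
  have hQ0 : 0 ≤ Q := div_nonneg (densityBound_pos hk).le hK.le
  have hY0 : 0 ≤ Y := pow_nonneg (by linarith) _
  have hY1 : Y ≤ 1 := pow_le_one₀ (by linarith) (by linarith)
  have hent (j : ℕ) := binEntropy_le_log_two_mul hb (by linarith) j
  suffices h : Q * Y + Real.binEntropy b < Real.log 2 by linarith
  have hquad := one_sub_pow_le_quadratic k hb (by linarith)
  rw [← hY] at hquad
  rcases Nat.lt_or_ge k 6 with h6 | h6
  · -- For `k = 4` and `k = 5` the density is far below the critical one.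
    have h3 := hent 3
    norm_num at h3
    have hQ' : Q ≤ 0.457 := by
      rw [hQ, div_le_iff₀ hK, densityBound_eq (by omega), binomTail_one]
      interval_cases k <;> norm_num <;> linarith
    have hY3 : Y ≤ 1 - 3 * b := by
      rcases (by omega : k = 4 ∨ k = 5) with rfl | rfl <;> norm_num at hquad <;> nlinarith
    have h1 : Q * Y ≤ 0.457 * (1 - 3 * b) := by gcongr
    have h2 : b * (3 * Real.log 2) ≤ b * (3 * 0.6931471808) := by gcongr
    linarith
  have hQ' := densityBound_div_le h6
  rw [← hQ] at hQ'
  have hε : (0 : ℝ) < (1 / 2) ^ k := by positivity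
  have hk6 : (6 : ℝ) ≤ k := by exact_mod_cast h6
  rcases le_or_gt (b * k ^ 2) 4 with hb4 | hb4
  · -- `b ≤ 4 / k ^ 2`: the loss `(k + 1) log 2 + 2` in the density compensates the entropy.
    have hYlin : Y ≤ 1 - (k - 2) * b := by nlinarith
    have h41 : (k - 2) * b ≤ 0.41 := by
      rcases Nat.lt_or_ge k 7 with h7 | h7
      · obtain rfl : k = 6 := by omega
        norm_num; linarith
      · have h7' : (7 : ℝ) ≤ k := by exact_mod_cast h7
        have hk2 : (0 : ℝ) < k ^ 2 := by positivity
        refine le_of_mul_le_mul_right ?_ hk2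
        nlinarith
    have he := hent (k - 2)
    have hpow : ((1 : ℝ) / 2) ^ (k - 2) = 4 * (1 / 2) ^ k := by
      obtain ⟨j, rfl⟩ : ∃ j, k = j + 2 := ⟨k - 2, by omega⟩
      simp [pow_add]; ring
    rw [hpow, Nat.cast_sub (by omega)] at he
    push_cast at he
    have h0 : 0 ≤ Real.log 2 - 6.85 * (1 / 2) ^ k := by linarith
    have h1 : Q * Y ≤ (Real.log 2 - 6.85 * (1 / 2) ^ k) * (1 - (k - 2) * b) := by gcongr
    nlinarith
  rcases Nat.lt_or_ge k 8 with h8 | h8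
  · have h7 : k = 7 := by
      by_contra h
      obtain rfl : k = 6 := by omega
      norm_num at hb4; linarith
    subst h7
    norm_num at hb4
    have hQ7 : Q ≤ 0.6304 := by
      rw [hQ, div_le_iff₀ hK, densityBound_eq (by omega), binomTail_one]
      norm_num; linarith
    have hY7 : Y ≤ (1 - 4 / 49) ^ 7 := pow_le_pow_left₀ (by linarith) (by linarith) _
    norm_num at hY7
    have h3 := hent 3
    norm_num at h3
    have h1 : Q * Y ≤ 0.6304 * (373669453125 / 678223072849) := by gcongr
    have h2 : b * (3 * Real.log 2) ≤ 1 / 10 * (3 * 0.6931471808) := by gcongr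
    norm_num at h1 h2
    linarith
  have hk8 : (8 : ℝ) ≤ k := by exact_mod_cast h8
  have hQl : Q * Y ≤ Real.log 2 * Y := by gcongr; linarith
  rcases le_or_gt (2 * (b * k)) 1 with hbk | hbk
  · -- `4 / k ^ 2 < b ≤ 1 / (2 k)`: the tail decays linearly, the entropy costs `b log (k ^ 2 / 4)`.
    have hbpos : 0 < b := by
      by_contra h
      obtain rfl : b = 0 := by linarith
      norm_num at hb4
    have hYlin : Y ≤ 1 - 3 / 4 * (k * b) := by nlinarith
    have hkpos : (0 : ℝ) < k := by linarith
    have he := binEntropy_le_tangent hb (by linarith) (s := 2 * Real.log (k / 2))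
    have hexp : Real.exp (-(2 * Real.log (k / 2))) ≤ b := by
      rw [Real.exp_neg, two_mul, Real.exp_add, Real.exp_log (by positivity)]
      rw [inv_le_comm₀ (by positivity) hbpos, inv_le_iff_one_le_mul₀ hbpos]
      nlinarith
    have hlog : Real.log (k / 2) ≤ 2 * Real.log 2 + (k / 8 - 1) := by
      have h := Real.log_le_sub_one_of_pos (show (0 : ℝ) < k / 8 by positivity)
      have h2 : (k : ℝ) / 2 = 2 ^ 2 * (k / 8) := by ring
      rw [h2, Real.log_mul (by norm_num) (by positivity), Real.log_pow]
      push_cast; linarith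
    have h1 : Real.log 2 * Y ≤ Real.log 2 * (1 - 3 / 4 * (k * b)) := by gcongr
    have h2 : 2 * Real.log (k / 2) + 1 < 3 / 4 * k * Real.log 2 := by nlinarith
    nlinarith
  -- `b > 1 / (2 k)`: the tail is bounded away from `1`.
  have hYexp : Y ≤ 0.6066 := by
    have h1 : Y ≤ Real.exp (-(1 / 2)) := by
      calc Y ≤ Real.exp (-b) ^ k := by
            have := Real.add_one_le_exp (-b)
            exact pow_le_pow_left₀ (by linarith) (by linarith) _
        _ = Real.exp (k * -b) := by rw [Real.exp_nat_mul]
        _ ≤ _ := by gcongr; linarith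
    have h2 : Real.exp (-(1 / 2)) ^ 2 < 0.6066 ^ 2 := by
      rw [← Real.exp_nat_mul]
      have := Real.exp_neg_one_lt_d9
      norm_num at *
      linarith
    have := lt_of_pow_lt_pow_left₀ 2 (by norm_num) h2
    linarith
  rcases le_or_gt b 0.07 with h | h
  · have h4 := hent 4
    norm_num at h4
    have h1 : Real.log 2 * Y ≤ 0.6931471808 * 0.6066 := by gcongr
    have h2 : b * (4 * Real.log 2) ≤ 0.07 * (4 * 0.6931471808) := by gcongr
    norm_num at h1 h2
    linarith
  have h3 := hent 3
  norm_num at h3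
  have hYb {c : ℝ} (hc : c ≤ b) : Y ≤ (1 - c) ^ 8 :=
    (pow_le_pow_of_le_one (by linarith) (by linarith) h8).trans
      (pow_le_pow_left₀ (by linarith) (by linarith) _)
  rcases le_or_gt b 0.085 with h' | h'
  · have h1 : Real.log 2 * Y ≤ 0.6931471808 * (1 - 0.07) ^ 8 := by gcongr; exact hYb h.le
    have h2 : b * (3 * Real.log 2) ≤ 0.085 * (3 * 0.6931471808) := by gcongr
    norm_num at h1 h2
    linarith
  · have h1 : Real.log 2 * Y ≤ 0.6931471808 * (1 - 0.085) ^ 8 := by gcongr; exact hYb h'.le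
    have h2 : b * (3 * Real.log 2) ≤ 1 / 10 * (3 * 0.6931471808) := by gcongr
    norm_num at h1 h2
    linarith

/-- Near overlap one half the rate of the second moment is dominated by the Gaussian decay
`x ^ 2 / 2` of the binomial coefficients. -/
lemma rate_le_quadratic {k : ℕ} (hk : 4 ≤ k) {x : ℝ} (hx : 0 ≤ x) (hx2 : x ≤ 4 / 5) :
    densityBound k * binomTail k x / binomTail k 1 ^ 2 ≤ 0.49 * x ^ 2 := by
  have hK := binomTail_one_pos hk
  have hR := densityBound_pos hk
  have hl := Real.log_two_gt_d9
  have hl2 := Real.log_two_lt_d9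
  have hend : densityBound k * binomTail k (4 / 5) / binomTail k 1 ^ 2 ≤ 0.3136 := by
    rcases Nat.lt_or_ge k 8 with h8 | h8
    · rw [div_le_iff₀ (by positivity), densityBound_eq (by omega), binomTail_one]
      simp only [binomTail]
      interval_cases k <;> norm_num <;> linarith
    · have h1 := densityBound_mul_binomTail_le hk (b := 1 / 10) (by norm_num) (by norm_num)
      have h2 := densityBound_div_le (by omega : 6 ≤ k)
      have h3 : (0 : ℝ) < (1 / 2) ^ k := by positivity
      have h4 : (1 - 1 / 10 : ℝ) ^ k ≤ (1 - 1 / 10) ^ 8 :=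
        pow_le_pow_of_le_one (by norm_num) (by norm_num) h8
      have h5 : (0 : ℝ) ≤ (1 - 1 / 10) ^ k := by positivity
      norm_num at h1 h4 h5
      have h6 : densityBound k / binomTail k 1 * (9 / 10) ^ k ≤ 0.6931471808 * (43046721 / 100000000) := by
        gcongr
        linarith
      norm_num at h6 ⊢
      linarith
  have h := sq_mul_binomTail_le k hx hx2
  rw [div_le_iff₀ (by positivity)] at hend ⊢
  have h2 : densityBound k * ((4 / 5) ^ 2 * binomTail k x) ≤
      densityBound k * (x ^ 2 * binomTail k (4 / 5)) := by gcongr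
  nlinarith [sq_nonneg x]

/-! ### Estimates for binomial coefficients -/

lemma centralBinom_sq_mul_le (n : ℕ) : (n.centralBinom : ℝ) ^ 2 * (2 * n + 1) ≤ 16 ^ n := by
  induction n with
  | zero => simp
  | succ n ih =>
    have h : ((n : ℝ) + 1) * (n + 1).centralBinom = 2 * (2 * n + 1) * n.centralBinom := by
      exact_mod_cast Nat.succ_mul_centralBinom_succ n
    have h2 : ((n : ℝ) + 1) ^ 2 * (((n + 1).centralBinom : ℝ) ^ 2 * (2 * (n + 1 : ℕ) + 1)) ≤
        (n + 1) ^ 2 * 16 ^ (n + 1) := by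
      push_cast
      calc _ = (((n : ℝ) + 1) * (n + 1).centralBinom) ^ 2 * (2 * n + 3) := by ring
        _ = 4 * ((n.centralBinom : ℝ) ^ 2 * (2 * n + 1)) * ((2 * n + 1) * (2 * n + 3)) := by
          rw [h]; ring
        _ ≤ 4 * 16 ^ n * (4 * (n + 1) ^ 2) := by
          refine mul_le_mul (by linarith) (by nlinarith) (by positivity) (by positivity)
        _ = _ := by ring
    exact le_of_mul_le_mul_left h2 (by positivity)

lemma le_mul_centralBinom_sq {n : ℕ} (hn : 1 ≤ n) :
    (16 : ℝ) ^ n ≤ 4 * n * (n.centralBinom : ℝ) ^ 2 := by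
  induction n, hn using Nat.le_induction with
  | base => norm_num [Nat.centralBinom]
  | succ n hn ih =>
    have hn0 : (0 : ℝ) < n := by exact_mod_cast hn
    have h : ((n : ℝ) + 1) * (n + 1).centralBinom = 2 * (2 * n + 1) * n.centralBinom := by
      exact_mod_cast Nat.succ_mul_centralBinom_succ n
    have h2 : (n * (n + 1) : ℝ) * 16 ^ (n + 1) ≤
        n * (n + 1) * (4 * (n + 1 : ℕ) * ((n + 1).centralBinom : ℝ) ^ 2) := by
      push_cast
      calc _ = 16 ^ n * (4 * (4 * n * (n + 1)) : ℝ) := by ring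
        _ ≤ (4 * n * (n.centralBinom : ℝ) ^ 2) * (4 * (2 * n + 1) ^ 2) := by
          gcongr
          nlinarith
        _ = 4 * n * (2 * (2 * n + 1) * n.centralBinom) ^ 2 := by ring
        _ = _ := by rw [← h]; ring
    exact le_of_mul_le_mul_left h2 (by positivity)

lemma one_sub_le_one_add_mul_exp {y : ℝ} (hy : 0 ≤ y) (hy1 : y ≤ 1) :
    1 - y ≤ (1 + y) * Real.exp (-(2 * y)) := by
  rcases hy1.eq_or_lt with rfl | hy1
  · norm_num; positivity
  have h1 : 0 < 1 - y := by linarith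
  have h := Real.le_log_one_add_of_nonneg (show 0 ≤ 2 * y / (1 - y) by positivity)
  have h2 : 2 * (2 * y / (1 - y)) / (2 * y / (1 - y) + 2) = 2 * y := by
    field_simp; ring
  have h3 : 1 + 2 * y / (1 - y) = (1 + y) / (1 - y) := by field_simp; ring
  rw [h2, h3, Real.le_log_iff_exp_le (by positivity), le_div_iff₀ h1] at h
  rw [Real.exp_neg, ← div_eq_mul_inv, le_div_iff₀ (Real.exp_pos _)]
  linarith

/-- Gaussian decay of the binomial coefficients around the central one. -/
lemma choose_add_le_gaussian {L j : ℕ} (hj : j ≤ L) :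
    ((2 * L).choose (L + j) : ℝ) ≤
      L.centralBinom * Real.exp (-(2 * (j : ℝ) ^ 2 / (2 * L + 1))) := by
  induction j with
  | zero => simp [Nat.centralBinom]
  | succ j ih =>
    have ih := ih (by omega)
    have hjL : (j : ℝ) + 1 ≤ L := by exact_mod_cast hj
    have hj0 : (0 : ℝ) ≤ j := by positivity
    have h : ((2 * L).choose (L + (j + 1)) : ℝ) * (L + j + 1) = (2 * L).choose (L + j) * (L - j) := by
      have h := Nat.choose_succ_right_eq (2 * L) (L + j)
      rw [show 2 * L - (L + j) = L - j by omega] at h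
      have h' : (((2 * L).choose (L + j + 1) * (L + j + 1) : ℕ) : ℝ) =
        (((2 * L).choose (L + j) * (L - j) : ℕ) : ℝ) := by exact_mod_cast h
      push_cast [Nat.cast_sub (show j ≤ L by omega)] at h'
      exact h'
    have hy := one_sub_le_one_add_mul_exp (y := (2 * j + 1) / (2 * L + 1)) (by positivity)
      (by rw [div_le_one (by positivity)]; linarith)
    have h1 : ((L : ℝ) - j) ≤ (L + j + 1) * Real.exp (-(2 * ((2 * j + 1) / (2 * L + 1)))) := by
      have e1 : (1 : ℝ) - (2 * j + 1) / (2 * L + 1) = (L - j) * (2 / (2 * L + 1)) := by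
        field_simp; ring
      have e2 : (1 : ℝ) + (2 * j + 1) / (2 * L + 1) = (L + j + 1) * (2 / (2 * L + 1)) := by
        field_simp; ring
      rw [e1, e2] at hy
      have : (0 : ℝ) < 2 / (2 * L + 1) := by positivity
      nlinarith
    have hpos : (0 : ℝ) < L + j + 1 := by positivity
    refine le_of_mul_le_mul_right ?_ hpos
    rw [h]
    calc ((2 * L).choose (L + j) : ℝ) * (L - j)
        ≤ (L.centralBinom * Real.exp (-(2 * (j : ℝ) ^ 2 / (2 * L + 1)))) *
          ((L + j + 1) * Real.exp (-(2 * ((2 * j + 1) / (2 * L + 1))))) := by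
          have : (0 : ℝ) ≤ L - j := by linarith
          gcongr
      _ = L.centralBinom * (Real.exp (-(2 * (j : ℝ) ^ 2 / (2 * L + 1))) *
          Real.exp (-(2 * ((2 * j + 1) / (2 * L + 1))))) * (L + j + 1) := by ring
      _ = _ := by
        rw [← Real.exp_add]
        congr 3
        push_cast
        field_simp
        ring

lemma choose_le_gaussian {L i : ℕ} (hi : i ≤ 2 * L) :
    ((2 * L).choose i : ℝ) ≤
      L.centralBinom * Real.exp (-(2 * ((i : ℝ) - L) ^ 2 / (2 * L + 1))) := by
  rcases le_total L i with h | h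
  · have := choose_add_le_gaussian (L := L) (j := i - L) (by omega)
    rwa [Nat.add_sub_cancel' h, Nat.cast_sub h] at this
  · have := choose_add_le_gaussian (L := L) (j := L - i) (by omega)
    rw [Nat.cast_sub h, ← Nat.choose_symm (by omega), show 2 * L - (L + (L - i)) = i by omega]
      at this
    rwa [← neg_sq, neg_sub]

/-- The entropy bound for binomial coefficients. -/
lemma choose_le_exp_binEntropy {n i : ℕ} (hi : i ≤ n) :
    (n.choose i : ℝ) ≤ Real.exp (n * Real.binEntropy (i / n)) := by
  rcases Nat.eq_zero_or_pos i with rfl | hi0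
  · simp
  rcases hi.eq_or_lt with rfl | hin
  · have : (i : ℝ) ≠ 0 := by positivity
    simp [this]
  have hi' : (0 : ℝ) < i := by exact_mod_cast hi0
  have hin' : (i : ℝ) < n := by exact_mod_cast hin
  have hn : (0 : ℝ) < n := by linarith
  set p : ℝ := i / n with hp
  have hp0 : 0 < p := by positivity
  have hp1 : p < 1 := by rw [hp, div_lt_one hn]; exact hin'
  have hq0 : 0 < 1 - p := by linarith
  have h1 : p ^ i * (1 - p) ^ (n - i) * n.choose i ≤ 1 := by
    have h := add_pow p (1 - p) n
    rw [add_sub_cancel, one_pow] at h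
    refine le_of_le_of_eq ?_ h.symm
    exact single_le_sum (f := fun m => p ^ m * (1 - p) ^ (n - m) * (n.choose m : ℝ))
      (fun m _ => by positivity) (mem_range.2 (by omega))
  have h2 : Real.exp (n * Real.binEntropy p) = (p ^ i * (1 - p) ^ (n - i))⁻¹ := by
    rw [← Real.exp_log (show 0 < (p ^ i * (1 - p) ^ (n - i))⁻¹ by positivity)]
    congr 1
    rw [Real.log_inv, Real.log_mul (by positivity) (by positivity), Real.log_pow, Real.log_pow,
      Real.binEntropy, Real.log_inv, Real.log_inv, Nat.cast_sub hi, hp]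
    field_simp
    ring
  rw [h2, ← one_div, le_div_iff₀ (by positivity)]
  linarith

/-! ### The sum over overlaps -/

lemma sum_exp_neg_sq_le {c : ℝ} (hc : 0 < c) {L : ℕ} (hL : 1 ≤ L) (n : ℕ) :
    ∑ d ∈ range n, Real.exp (-(c * (d : ℝ) ^ 2 / L)) ≤ Real.exp c * (1 + √L / (2 * c)) := by
  have hL0 : (0 : ℝ) < L := by exact_mod_cast hL
  have hs : 0 < √(L : ℝ) := Real.sqrt_pos.2 hL0
  set s := 2 * c / √(L : ℝ) with hsdef
  have hs0 : 0 < s := by positivity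
  -- `d ^ 2 / L ≥ 2 d / √L - 1` turns the Gaussian sum into a geometric one.
  have hterm (d : ℕ) : Real.exp (-(c * (d : ℝ) ^ 2 / L)) ≤ Real.exp c * Real.exp (-s) ^ d := by
    rw [← Real.exp_nat_mul, ← Real.exp_add, Real.exp_le_exp]
    have h : (0 : ℝ) ≤ c * (d / √(L : ℝ) - 1) ^ 2 := by positivity
    have h2 : c * ((d : ℝ) / √(L : ℝ) - 1) ^ 2 = c * (d : ℝ) ^ 2 / L - d * s + c := by
      have e : c * (d : ℝ) ^ 2 / L = c * (d : ℝ) ^ 2 / √(L : ℝ) ^ 2 := by rw [Real.sq_sqrt hL0.le]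
      rw [hsdef, e]
      field_simp
      ring
    linarith
  have hexp1 : Real.exp (-s) < 1 := Real.exp_lt_one_iff.2 (by linarith)
  have hgeom : ∑ d ∈ range n, Real.exp (-s) ^ d ≤ (1 - Real.exp (-s))⁻¹ := by
    have h0 : 0 < 1 - Real.exp (-s) := by linarith
    rw [← one_div, le_div_iff₀ h0, mul_comm, mul_neg_geom_sum]
    have := pow_nonneg (Real.exp_nonneg (-s)) n
    linarith
  have hinv : (1 - Real.exp (-s))⁻¹ ≤ 1 + √L / (2 * c) := by
    have h1 : Real.exp (-s) ≤ 1 / (1 + s) := by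
      rw [Real.exp_neg, ← one_div]
      gcongr
      linarith [Real.add_one_le_exp s]
    have h2 : s / (1 + s) ≤ 1 - Real.exp (-s) := by
      have : 1 - 1 / (1 + s) = s / (1 + s) := by field_simp; ring
      linarith
    have h3 : 1 + √L / (2 * c) = (s / (1 + s))⁻¹ := by
      rw [hsdef]; field_simp; ring
    rw [h3]
    gcongr
  calc _ ≤ ∑ d ∈ range n, Real.exp c * Real.exp (-s) ^ d := sum_le_sum fun d _ => hterm d
    _ = Real.exp c * ∑ d ∈ range n, Real.exp (-s) ^ d := by rw [mul_sum]
    _ ≤ _ := by gcongr; exact hgeom.trans hinv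

lemma sum_exp_neg_centered_sq_le {c : ℝ} (hc : 0 < c) {L : ℕ} (hL : 1 ≤ L) :
    ∑ i ∈ range (2 * L + 1), Real.exp (-(c * ((i : ℝ) - L) ^ 2 / L)) ≤
      2 * (Real.exp c * (1 + √L / (2 * c))) := by
  rw [show 2 * L + 1 = L + (L + 1) by ring, sum_range_add, two_mul]
  gcongr
  · rw [← sum_range_reflect]
    refine le_trans ?_ (sum_exp_neg_sq_le hc hL (L + 1))
    rw [sum_range_succ']
    refine le_add_of_le_of_nonneg (sum_le_sum fun j hj => le_of_eq ?_) (Real.exp_nonneg _)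
    rw [mem_range] at hj
    rw [Nat.cast_sub (by omega), Nat.cast_sub (by omega)]
    push_cast
    ring_nf
  · refine le_trans (sum_le_sum fun j _ => le_of_eq ?_) (sum_exp_neg_sq_le hc hL (L + 1))
    push_cast
    ring_nf

/-- The sum over overlaps which, divided by `(4L choose 2L)`, is the ratio between the second
moment and the square of the first moment. -/
noncomputable def overlapSum (k L M : ℕ) : ℝ :=
  ∑ i ∈ range (2 * L + 1), ((2 * L).choose i : ℝ) ^ 2 *
    (1 + binomTail k ((i : ℝ) / L - 1) / binomTail k 1 ^ 2) ^ (2 * M)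

/-- By compactness the rate for overlaps far from one half is negative uniformly. -/
lemma exists_rate_gap {k : ℕ} (hk : 4 ≤ k) : ∃ η > 0, ∀ b : ℝ, 0 ≤ b → b ≤ 1 / 10 →
    densityBound k * binomTail k (1 - 2 * b) / binomTail k 1 ^ 2 + Real.binEntropy b ≤
      Real.log 2 - η := by
  have hcont : ContinuousOn (fun b : ℝ => densityBound k * binomTail k (1 - 2 * b) /
      binomTail k 1 ^ 2 + Real.binEntropy b) (Set.Icc 0 (1 / 10)) := by
    unfold binomTail
    fun_prop
  obtain ⟨b₀, hb₀, hmax⟩ := isCompact_Icc.exists_isMaxOn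
    (Set.nonempty_Icc.2 (by norm_num : (0 : ℝ) ≤ 1 / 10)) hcont
  refine ⟨_, sub_pos.2 (rate_lt_log_two hk hb₀.1 hb₀.2), fun b h0 h1 => ?_⟩
  have := hmax (show b ∈ Set.Icc (0 : ℝ) (1 / 10) from ⟨h0, h1⟩)
  simp only [Set.mem_ofPred_eq] at this
  linarith

lemma overlap_factor_le {k L M i : ℕ} (hk : 4 ≤ k) (hL : 1 ≤ L)
    (hM : (2 * M : ℝ) ≤ densityBound k * (4 * L)) :
    (1 + binomTail k ((i : ℝ) / L - 1) / binomTail k 1 ^ 2) ^ (2 * M) ≤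
      Real.exp (4 * L * (densityBound k * binomTail k |(i : ℝ) / L - 1| / binomTail k 1 ^ 2)) := by
  have hK := binomTail_one_pos hk
  set x : ℝ := (i : ℝ) / L - 1 with hx
  have hx1 : -1 ≤ x := by
    have : (0 : ℝ) ≤ (i : ℝ) / L := by positivity
    linarith
  have h0 := binomTail_nonneg k hx1
  have h0' := binomTail_nonneg k (by linarith [abs_nonneg x] : -1 ≤ |x|)
  have h1 : 1 + binomTail k x / binomTail k 1 ^ 2 ≤
      Real.exp (binomTail k |x| / binomTail k 1 ^ 2) := by
    have h2 : binomTail k x / binomTail k 1 ^ 2 ≤ binomTail k |x| / binomTail k 1 ^ 2 := by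
      gcongr; exact binomTail_le_binomTail_abs k hx1
    linarith [Real.add_one_le_exp (binomTail k |x| / binomTail k 1 ^ 2)]
  calc _ ≤ (Real.exp (binomTail k |x| / binomTail k 1 ^ 2)) ^ (2 * M) := by gcongr
    _ = Real.exp (2 * M * (binomTail k |x| / binomTail k 1 ^ 2)) := by
      rw [← Real.exp_nat_mul]; push_cast; rfl
    _ ≤ Real.exp (densityBound k * (4 * L) * (binomTail k |x| / binomTail k 1 ^ 2)) := by gcongr
    _ = _ := by ring_nf

lemma overlap_term_near_le {k L M i : ℕ} (hk : 4 ≤ k) (hL : 50 ≤ L) (hi : i ≤ 2 * L)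
    (hM : (2 * M : ℝ) ≤ densityBound k * (4 * L)) (hx : |(i : ℝ) / L - 1| ≤ 4 / 5) :
    ((2 * L).choose i : ℝ) ^ 2 *
      (1 + binomTail k ((i : ℝ) / L - 1) / binomTail k 1 ^ 2) ^ (2 * M) ≤
      (L.centralBinom : ℝ) ^ 2 * Real.exp (-(0.02 * ((i : ℝ) - L) ^ 2 / L)) := by
  have hL0 : (50 : ℝ) ≤ L := by exact_mod_cast hL
  have hLpos : (0 : ℝ) < L := by linarith
  have h1 := overlap_factor_le (i := i) hk (by omega) hM
  have h2 := rate_le_quadratic hk (abs_nonneg ((i : ℝ) / L - 1)) hx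
  rw [sq_abs] at h2
  have h3 := choose_le_gaussian hi
  have hpos : (0 : ℝ) ≤ (1 + binomTail k ((i : ℝ) / L - 1) / binomTail k 1 ^ 2) ^ (2 * M) :=
    (even_two_mul M).pow_nonneg _
  calc _ ≤ (L.centralBinom * Real.exp (-(2 * ((i : ℝ) - L) ^ 2 / (2 * L + 1)))) ^ 2 *
        Real.exp (4 * L * (0.49 * ((i : ℝ) / L - 1) ^ 2)) := by
        gcongr
        exact h1.trans (by gcongr)
    _ = (L.centralBinom : ℝ) ^ 2 * (Real.exp (2 * -(2 * ((i : ℝ) - L) ^ 2 / (2 * L + 1)) +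
        4 * L * (0.49 * ((i : ℝ) / L - 1) ^ 2))) := by
        rw [mul_pow, Real.exp_add, mul_assoc, ← Real.exp_nat_mul]; push_cast; rfl
    _ ≤ _ := by
        gcongr
        have e1 : 4 * (L : ℝ) * (0.49 * ((i : ℝ) / L - 1) ^ 2) = 1.96 * (((i : ℝ) - L) ^ 2 / L) := by
          field_simp; ring
        have e2 : 0.99 * (((i : ℝ) - L) ^ 2 / L) ≤ 2 * ((i : ℝ) - L) ^ 2 / (2 * L + 1) := by
          rw [mul_div_assoc', div_le_div_iff₀ hLpos (by positivity)]
          have := sq_nonneg ((i : ℝ) - L)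
          nlinarith
        have e3 : 0.02 * ((i : ℝ) - L) ^ 2 / L = 0.02 * (((i : ℝ) - L) ^ 2 / L) := mul_div_assoc ..
        rw [e1, e3]
        linarith

lemma overlap_term_far_le {k L M i : ℕ} {η : ℝ} (hk : 4 ≤ k) (hL : 1 ≤ L) (hi : i ≤ 2 * L)
    (hη : ∀ b : ℝ, 0 ≤ b → b ≤ 1 / 10 → densityBound k * binomTail k (1 - 2 * b) /
      binomTail k 1 ^ 2 + Real.binEntropy b ≤ Real.log 2 - η)
    (hM : (2 * M : ℝ) ≤ densityBound k * (4 * L)) (hx : 4 / 5 < |(i : ℝ) / L - 1|) :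
    ((2 * L).choose i : ℝ) ^ 2 *
      (1 + binomTail k ((i : ℝ) / L - 1) / binomTail k 1 ^ 2) ^ (2 * M) ≤
      16 ^ L * Real.exp (-(4 * η * L)) := by
  have hLpos : (0 : ℝ) < L := by exact_mod_cast hL
  have h1 := overlap_factor_le (i := i) hk hL hM
  set x : ℝ := (i : ℝ) / L - 1 with hxdef
  have hi' : (i : ℝ) ≤ 2 * L := by exact_mod_cast hi
  have hxabs : |x| ≤ 1 := by
    have h0 : (0 : ℝ) ≤ (i : ℝ) / L := by positivity
    have h2 : (i : ℝ) / L ≤ 2 := by rw [div_le_iff₀ hLpos]; exact hi'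
    rw [abs_le]; constructor <;> linarith
  have hent : Real.binEntropy ((i : ℝ) / (2 * L : ℕ)) = Real.binEntropy ((1 - |x|) / 2) := by
    have e : (i : ℝ) / (2 * L : ℕ) = (1 + x) / 2 := by
      rw [hxdef]; push_cast; field_simp; ring
    rw [e]
    rcases abs_cases x with ⟨h, -⟩ | ⟨h, -⟩
    · rw [h, ← Real.binEntropy_one_sub]; ring_nf
    · rw [h]; ring_nf
  have h3 := choose_le_exp_binEntropy hi
  rw [hent] at h3
  have h4 := hη ((1 - |x|) / 2) (by linarith) (by linarith)
  rw [show 1 - 2 * ((1 - |x|) / 2) = |x| by ring] at h4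
  have hpos : (0 : ℝ) ≤ (1 + binomTail k x / binomTail k 1 ^ 2) ^ (2 * M) :=
    (even_two_mul M).pow_nonneg _
  calc _ ≤ (Real.exp ((2 * L : ℕ) * Real.binEntropy ((1 - |x|) / 2))) ^ 2 *
        Real.exp (4 * L * (densityBound k * binomTail k |x| / binomTail k 1 ^ 2)) := by gcongr
    _ = Real.exp (4 * L * (densityBound k * binomTail k |x| / binomTail k 1 ^ 2 +
        Real.binEntropy ((1 - |x|) / 2))) := by
        rw [← Real.exp_nat_mul, ← Real.exp_add]; push_cast; ring_nf
    _ ≤ Real.exp (4 * L * (Real.log 2 - η)) := by gcongr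
    _ = _ := by
        rw [show 4 * (L : ℝ) * (Real.log 2 - η) = L * (4 * Real.log 2) + -(4 * η * L) by ring,
          Real.exp_add, Real.exp_nat_mul]
        congr 2
        rw [show (4 : ℝ) * Real.log 2 = (4 : ℕ) * Real.log 2 by norm_num, Real.exp_nat_mul,
          Real.exp_log two_pos]
        norm_num

/-- Below the density bound the second moment is within a constant factor of the square of the
first moment. Overlaps close to one half contribute a Gaussian sum of order `√L`, which the ratio
of central binomial coefficients cancels; the others are exponentially negligible. -/
lemma eventually_overlapSum_le {k : ℕ} (hk : 4 ≤ k) :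
    ∀ᶠ L : ℕ in atTop, ∀ M : ℕ, (2 * M : ℝ) ≤ densityBound k * (4 * L) →
      overlapSum k L M ≤ 157 * (4 * L).choose (2 * L) := by
  obtain ⟨η, hη0, hη⟩ := exists_rate_gap hk
  have hsmall : ∀ᶠ L : ℕ in atTop,
      8 * ((L : ℝ) ^ 2 * Real.exp (-(4 * η * L))) * 3 ≤ 1 := by
    have h := Real.tendsto_pow_mul_exp_neg_atTop_nhds_zero 2
    have h2 : Tendsto (fun L : ℕ => 4 * η * (L : ℝ)) atTop atTop :=
      tendsto_natCast_atTop_atTop.const_mul_atTop (by positivity)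
    have h3 := (h.comp h2).const_mul (24 / (4 * η) ^ 2)
    rw [mul_zero] at h3
    filter_upwards [h3.eventually_le_const one_pos] with L hL
    refine le_trans (le_of_eq ?_) hL
    simp only [Function.comp]
    field_simp
    ring
  filter_upwards [hsmall, eventually_ge_atTop 50] with L hsm hL M hM
  have hL0 : (50 : ℝ) ≤ L := by exact_mod_cast hL
  have hLpos : (0 : ℝ) < L := by linarith
  set B : ℝ := ((4 * L).choose (2 * L) : ℝ) with hB
  have hB0 : 0 ≤ B := by positivity
  have hBcb : B = (2 * L).centralBinom := by
    rw [hB, Nat.centralBinom]; congr 2; ring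
  have hlow : (16 : ℝ) ^ L * 16 ^ L ≤ 8 * L * B ^ 2 := by
    have := le_mul_centralBinom_sq (n := 2 * L) (by omega)
    rw [← hBcb, two_mul, pow_add] at this
    push_cast at this
    linarith
  -- Here `√8` is rounded up to `3`.
  have hlow2 : (16 : ℝ) ^ L ≤ 3 * √L * B := by
    refine abs_le_of_sq_le_sq' (a := (16 : ℝ) ^ L) ?_ (by positivity) |>.2
    rw [mul_pow, mul_pow, Real.sq_sqrt hLpos.le]
    nlinarith [sq_nonneg B]
  have hsum : overlapSum k L M ≤ ∑ i ∈ range (2 * L + 1),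
      ((L.centralBinom : ℝ) ^ 2 * Real.exp (-(0.02 * ((i : ℝ) - L) ^ 2 / L)) +
        16 ^ L * Real.exp (-(4 * η * L))) := by
    refine sum_le_sum fun i hi => ?_
    have hi : i ≤ 2 * L := by rw [mem_range] at hi; omega
    rcases le_or_gt |(i : ℝ) / L - 1| (4 / 5) with hx | hx
    · exact (overlap_term_near_le hk hL hi hM hx).trans (le_add_of_nonneg_right (by positivity))
    · exact (overlap_term_far_le hk (by omega) hi hη hM hx).trans
        (le_add_of_nonneg_left (by positivity))
  rw [sum_add_distrib, ← mul_sum, sum_const, card_range, nsmul_eq_mul] at hsum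
  have hgauss := sum_exp_neg_centered_sq_le (c := 0.02) (by norm_num) (L := L) (by omega)
  have hs : 1 ≤ √(L : ℝ) := Real.one_le_sqrt.2 (by linarith)
  have hss : √(L : ℝ) * √L = L := Real.mul_self_sqrt hLpos.le
  have hexp : Real.exp 0.02 ≤ 1.1 := by
    have h := Real.exp_bound_div_one_sub_of_interval (x := 0.02) (by norm_num) (by norm_num)
    norm_num at h ⊢
    linarith
  have hnear : (L.centralBinom : ℝ) ^ 2 * ∑ i ∈ range (2 * L + 1),
      Real.exp (-(0.02 * ((i : ℝ) - L) ^ 2 / L)) ≤ 156 * B := by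
    have hup := centralBinom_sq_mul_le L
    have h1 : (L.centralBinom : ℝ) ^ 2 * (2 * L) ≤ 3 * √L * B := by
      have : (0 : ℝ) ≤ (L.centralBinom : ℝ) ^ 2 := by positivity
      nlinarith
    have h2 : (L.centralBinom : ℝ) ^ 2 * √L ≤ 1.5 * B := by
      have hs0 : 0 < √(L : ℝ) := by linarith
      refine le_of_mul_le_mul_right ?_ hs0
      calc (L.centralBinom : ℝ) ^ 2 * √L * √L = (L.centralBinom : ℝ) ^ 2 * L := by
            rw [mul_assoc, hss]
        _ ≤ 1.5 * B * √L := by linarith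
    calc _ ≤ (L.centralBinom : ℝ) ^ 2 * (2 * (1.1 * (√L + √L / (2 * 0.02)))) := by
          gcongr
          refine hgauss.trans ?_
          gcongr
      _ = 57.2 * ((L.centralBinom : ℝ) ^ 2 * √L) := by ring
      _ ≤ 156 * B := by linarith
  have hfar : ((2 * L + 1 : ℕ) : ℝ) * (16 ^ L * Real.exp (-(4 * η * L))) ≤ 1 * B := by
    have hsL : √(L : ℝ) ≤ L := by nlinarith
    calc _ ≤ (3 * L : ℝ) * (3 * L * B * Real.exp (-(4 * η * L))) := by
          have : ((2 * L + 1 : ℕ) : ℝ) ≤ 3 * L := by push_cast; linarith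
          gcongr
          refine hlow2.trans (by gcongr)
      _ = (9 * ((L : ℝ) ^ 2 * Real.exp (-(4 * η * L)))) * B := by ring
      _ ≤ 1 * B := by
          gcongr
          have : 0 ≤ (L : ℝ) ^ 2 * Real.exp (-(4 * η * L)) := by positivity
          linarith
  linarith

/-! ### The weighted second moment for independent uniform tuples -/

section ClauseWeight

variable {V : Type*} {k : ℕ}

/-- The weight of a tuple `τ` under `χ : V → {1, -1}`, where `χ v = -1` means that `v` belongs to
the candidate cover. It vanishes if the tuple misses the cover, that is if `χ` is constantly `1` on
`τ`, and otherwise it is `1 - 2 ^ (1 - k) * j`, where `j` is the number of entries of `τ` in the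
cover. The slope is chosen so that the Fourier coefficients of degree one vanish. -/
noncomputable def clauseWeight (χ : V → ℝ) (τ : Fin k → V) : ℝ :=
  1 - k / 2 ^ k - ∏ i, (1 + χ (τ i)) / 2 + (∑ i, χ (τ i)) / 2 ^ k

lemma clauseWeight_eq_zero {χ : V → ℝ} {τ : Fin k → V} (h : ∀ i, χ (τ i) = 1) :
    clauseWeight χ τ = 0 := by
  simp [clauseWeight, h]

variable [Fintype V]

lemma sum_tuple_one : ∑ _τ : Fin k → V, (1 : ℝ) = (Fintype.card V : ℝ) ^ k := by
  simp

lemma sum_tuple_prod {χ : V → ℝ} (h : ∑ v, χ v = 0) :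
    ∑ τ : Fin k → V, ∏ i, (1 + χ (τ i)) / 2 = ((Fintype.card V : ℝ) / 2) ^ k := by
  rw [← Fintype.sum_pow fun v => (1 + χ v) / 2, ← sum_div, sum_add_distrib, h]
  simp

lemma sum_tuple_apply {χ : V → ℝ} (h : ∑ v, χ v = 0) (j : Fin k) :
    ∑ τ : Fin k → V, χ (τ j) = 0 := by
  have h1 (τ : Fin k → V) : χ (τ j) = ∏ i, (if i = j then χ (τ i) else 1) := by simp
  simp_rw [h1]
  rw [← Fintype.prod_sum fun (i : Fin k) (v : V) => if i = j then χ v else 1]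
  exact prod_eq_zero (mem_univ j) (by simpa using h)

lemma sum_tuple_prod_mul_prod {χ χ' : V → ℝ} {x : ℝ} (h : ∑ v, χ v = 0) (h' : ∑ v, χ' v = 0)
    (hx : ∑ v, χ v * χ' v = x * Fintype.card V) :
    ∑ τ : Fin k → V, (∏ i, (1 + χ (τ i)) / 2) * ∏ i, (1 + χ' (τ i)) / 2 =
      ((1 + x) * Fintype.card V / 4) ^ k := by
  simp_rw [← prod_mul_distrib]
  rw [← Fintype.sum_pow fun v => (1 + χ v) / 2 * ((1 + χ' v) / 2)]
  congr 1
  calc ∑ v, (1 + χ v) / 2 * ((1 + χ' v) / 2)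
      = ∑ v, (1 / 4 + χ v / 4 + χ' v / 4 + χ v * χ' v / 4) := sum_congr rfl fun v _ => by ring
    _ = _ := by
      simp only [sum_add_distrib, ← sum_div, h, h', hx]
      simp
      ring

lemma sum_tuple_prod_mul_apply {χ χ' : V → ℝ} {x : ℝ} (h : ∑ v, χ v = 0) (h' : ∑ v, χ' v = 0)
    (hx : ∑ v, χ v * χ' v = x * Fintype.card V) (j : Fin k) :
    ∑ τ : Fin k → V, (∏ i, (1 + χ (τ i)) / 2) * χ' (τ j) =
      x * ((Fintype.card V : ℝ) / 2) ^ k := by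
  have h1 (τ : Fin k → V) : (∏ i, (1 + χ (τ i)) / 2) * χ' (τ j) =
      ∏ i, ((1 + χ (τ i)) / 2 * if i = j then χ' (τ i) else 1) := by
    rw [prod_mul_distrib]; simp
  simp_rw [h1]
  rw [← Fintype.prod_sum fun (i : Fin k) (v : V) => (1 + χ v) / 2 * if i = j then χ' v else 1]
  have h2 (i : Fin k) : ∑ v, (1 + χ v) / 2 * (if i = j then χ' v else 1) =
      (Fintype.card V : ℝ) / 2 * if i = j then x else 1 := by
    split_ifs
    · calc ∑ v, (1 + χ v) / 2 * χ' v = ∑ v, (χ' v / 2 + χ v * χ' v / 2) :=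
            sum_congr rfl fun v _ => by ring
        _ = _ := by
          simp only [sum_add_distrib, ← sum_div, h', hx]; ring
    · simp only [mul_one, ← sum_div, sum_add_distrib, h]; simp
  simp_rw [h2]
  rw [prod_mul_distrib]
  simp [div_pow]
  ring

lemma sum_tuple_apply_mul_apply {χ χ' : V → ℝ} {x : ℝ} (h : ∑ v, χ v = 0)
    (hx : ∑ v, χ v * χ' v = x * Fintype.card V) (i j : Fin k) :
    ∑ τ : Fin k → V, χ (τ i) * χ' (τ j) =
      if i = j then x * (Fintype.card V : ℝ) ^ k else 0 := by
  have h1 (τ : Fin k → V) : χ (τ i) * χ' (τ j) =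
      ∏ l, ((if l = i then χ (τ l) else 1) * if l = j then χ' (τ l) else 1) := by
    rw [prod_mul_distrib]; simp
  simp_rw [h1]
  rw [← Fintype.prod_sum fun (l : Fin k) (v : V) =>
    (if l = i then χ v else 1) * if l = j then χ' v else 1]
  split_ifs with hij
  · subst hij
    have h2 (l : Fin k) : ∑ v, (if l = i then χ v else 1) * (if l = i then χ' v else 1) =
        (Fintype.card V : ℝ) * if l = i then x else 1 := by
      split_ifs
      · rw [hx]; ring
      · simp
    simp_rw [h2]
    rw [prod_mul_distrib]
    simp
    ring
  · refine prod_eq_zero (mem_univ i) ?_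
    simpa [hij] using h

lemma sum_clauseWeight {χ : V → ℝ} (h : ∑ v, χ v = 0) :
    ∑ τ : Fin k → V, clauseWeight χ τ =
      (Fintype.card V : ℝ) ^ k * (binomTail k 1 / 2 ^ k) := by
  simp only [clauseWeight, sum_add_distrib, sum_sub_distrib, sum_tuple_prod h, ← sum_div]
  rw [sum_comm]
  simp only [sum_tuple_apply h, sum_const_zero, sum_const, card_univ, Fintype.card_fun,
    Fintype.card_fin, nsmul_eq_mul, binomTail_one, div_pow]
  push_cast
  field_simp
  ring

/-- The weight has no Fourier coefficients of degree one, so the correlation of the weights of a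
random tuple under two balanced assignments has no linear term in their correlation `x`. -/
lemma sum_clauseWeight_mul {χ χ' : V → ℝ} {x : ℝ} (h : ∑ v, χ v = 0) (h' : ∑ v, χ' v = 0)
    (hx : ∑ v, χ v * χ' v = x * Fintype.card V) :
    ∑ τ : Fin k → V, clauseWeight χ τ * clauseWeight χ' τ =
      (Fintype.card V : ℝ) ^ k * ((binomTail k 1 / 2 ^ k) ^ 2 + binomTail k x / 4 ^ k) := by
  have hx' : ∑ v, χ' v * χ v = x * Fintype.card V := by simp_rw [mul_comm (χ' _)]; exact hx
  set c : ℝ := 1 - k / 2 ^ k with hc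
  obtain ⟨a, ha⟩ : ∃ a : (Fin k → V) → ℝ, ∀ τ, ∏ i, (1 + χ (τ i)) / 2 = a τ := ⟨_, fun _ => rfl⟩
  obtain ⟨a', ha'⟩ : ∃ a : (Fin k → V) → ℝ, ∀ τ, ∏ i, (1 + χ' (τ i)) / 2 = a τ :=
    ⟨_, fun _ => rfl⟩
  obtain ⟨s, hs⟩ : ∃ s : (Fin k → V) → ℝ, ∀ τ, ∑ i, χ (τ i) = s τ := ⟨_, fun _ => rfl⟩
  obtain ⟨s', hs'⟩ : ∃ s : (Fin k → V) → ℝ, ∀ τ, ∑ i, χ' (τ i) = s τ := ⟨_, fun _ => rfl⟩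
  have e1 : ∑ τ, a τ = ((Fintype.card V : ℝ) / 2) ^ k := by
    simp_rw [← ha]; exact sum_tuple_prod h
  have e2 : ∑ τ, a' τ = ((Fintype.card V : ℝ) / 2) ^ k := by
    simp_rw [← ha']; exact sum_tuple_prod h'
  have e3 : ∑ τ, s τ = 0 := by
    simp_rw [← hs]; rw [sum_comm]; simp [sum_tuple_apply h]
  have e4 : ∑ τ, s' τ = 0 := by
    simp_rw [← hs']; rw [sum_comm]; simp [sum_tuple_apply h']
  have e5 : ∑ τ, a τ * a' τ = ((1 + x) * Fintype.card V / 4) ^ k := by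
    simp_rw [← ha, ← ha']; exact sum_tuple_prod_mul_prod h h' hx
  have e6 : ∑ τ, a τ * s' τ = k * (x * ((Fintype.card V : ℝ) / 2) ^ k) := by
    simp_rw [← ha, ← hs', mul_sum]
    rw [sum_comm]
    rw [sum_congr rfl fun j _ => sum_tuple_prod_mul_apply h h' hx j]
    simp
  have e7 : ∑ τ, a' τ * s τ = k * (x * ((Fintype.card V : ℝ) / 2) ^ k) := by
    simp_rw [← ha', ← hs, mul_sum]
    rw [sum_comm]
    rw [sum_congr rfl fun j _ => sum_tuple_prod_mul_apply h' h hx' j]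
    simp
  have e8 : ∑ τ, s τ * s' τ = k * (x * (Fintype.card V : ℝ) ^ k) := by
    simp_rw [← hs, ← hs', sum_mul_sum]
    rw [sum_comm]
    calc _ = ∑ i : Fin k, ∑ j : Fin k, ∑ τ : Fin k → V, χ (τ i) * χ' (τ j) :=
          sum_congr rfl fun i _ => sum_comm
      _ = _ := by simp_rw [sum_tuple_apply_mul_apply h hx]; simp
  have hexpand (τ : Fin k → V) : clauseWeight χ τ * clauseWeight χ' τ =
      c ^ 2 * 1 - c * a τ - c * a' τ + (c / 2 ^ k) * s τ + (c / 2 ^ k) * s' τ + a τ * a' τ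
      - (1 / 2 ^ k) * (a τ * s' τ) - (1 / 2 ^ k) * (a' τ * s τ)
      + (1 / 2 ^ k) ^ 2 * (s τ * s' τ) := by
    simp only [clauseWeight, ← hc, ha, ha', hs, hs']
    ring
  simp_rw [hexpand]
  simp only [sum_add_distrib, sum_sub_distrib, ← mul_sum, e1, e2, e3, e4, e5, e6, e7, e8,
    sum_tuple_one]
  have h4 : (4 : ℝ) ^ k = 2 ^ k * 2 ^ k := by rw [← mul_pow]; norm_num
  simp only [binomTail, div_pow, mul_pow, hc, h4]
  field_simp
  ring

end ClauseWeight

section SecondMoment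

variable {V : Type*} [DecidableEq V]

/-- The sign function of a vertex set: `-1` on the set, `1` off it. -/
def sign (A : Finset V) (v : V) : ℝ := if v ∈ A then -1 else 1

lemma sign_eq (A : Finset V) (v : V) : sign A v = 1 - 2 * if v ∈ A then 1 else 0 := by
  unfold sign; split_ifs <;> norm_num

variable [Fintype V]

lemma sum_sign {L : ℕ} (hV : Fintype.card V = 4 * L) {A : Finset V} (hA : #A = 2 * L) :
    ∑ v, sign A v = 0 := by
  simp only [sign_eq, sum_sub_distrib, ← mul_sum]
  simp [hV, hA]
  ring

lemma sum_sign_mul_sign {L : ℕ} (hL : 1 ≤ L) (hV : Fintype.card V = 4 * L) {A B : Finset V}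
    (hA : #A = 2 * L) (hB : #B = 2 * L) :
    ∑ v, sign A v * sign B v = ((#(A ∩ B) : ℝ) / L - 1) * Fintype.card V := by
  have h (v : V) : sign A v * sign B v = 1 - 2 * (if v ∈ A then 1 else 0) -
      2 * (if v ∈ B then 1 else 0) + 4 * if v ∈ A ∩ B then 1 else 0 := by
    simp only [sign_eq, mem_inter]
    by_cases h1 : v ∈ A <;> by_cases h2 : v ∈ B <;> norm_num [h1, h2]
  have hL0 : (L : ℝ) ≠ 0 := by positivity
  simp_rw [h]
  simp only [sum_add_distrib, sum_sub_distrib, ← mul_sum]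
  simp only [sum_boole, filter_mem_eq_inter, univ_inter, sum_const, card_univ, nsmul_eq_mul, mul_one,
    hA, hB, hV]
  push_cast
  field_simp
  ring

lemma card_inter_eq_le {L : ℕ} (hV : Fintype.card V = 4 * L) {A : Finset V} (hA : #A = 2 * L)
    (i : ℕ) : #{B ∈ powersetCard (2 * L) (univ : Finset V) | #(A ∩ B) = i} ≤
      (2 * L).choose i ^ 2 := by
  rcases Nat.lt_or_ge (2 * L) i with hi | hi
  · rw [filter_eq_empty_iff.2 fun B _ h => ?_]
    · simp
    · have := card_le_card (inter_subset_left (s₁ := A) (s₂ := B))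
      omega
  have hcard : #(powersetCard i A ×ˢ powersetCard (2 * L - i) Aᶜ) = (2 * L).choose i ^ 2 := by
    rw [card_product, card_powersetCard, card_powersetCard, card_compl, hA, hV,
      show 4 * L - 2 * L = 2 * L by omega, Nat.choose_symm hi, sq]
  rw [← hcard]
  refine card_le_card_of_injOn (fun B => (A ∩ B, Aᶜ ∩ B)) ?_ ?_
  · intro B hB
    simp only [coe_filter, mem_powersetCard, subset_univ, true_and, Set.mem_ofPred_eq] at hB
    have h1 : #(A ∩ B) + #(Aᶜ ∩ B) = #B := by
      rw [← card_union_of_disjoint]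
      · rw [← union_inter_distrib_right, union_compl, univ_inter]
      · exact disjoint_compl_right.mono inter_subset_left inter_subset_left
    simp only [mem_coe, mem_product, mem_powersetCard]
    exact ⟨⟨inter_subset_left, hB.2⟩, inter_subset_left, by omega⟩
  · intro B _ B' _ h
    simp only [Prod.mk.injEq] at h
    calc B = (A ∩ B) ∪ (Aᶜ ∩ B) := by
          rw [← union_inter_distrib_right, union_compl, univ_inter]
      _ = B' := by rw [h.1, h.2, ← union_inter_distrib_right, union_compl, univ_inter]

lemma sum_overlap_le {L : ℕ} (hV : Fintype.card V = 4 * L) {A : Finset V} (hA : #A = 2 * L)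
    {F : ℕ → ℝ} (hF : ∀ i, 0 ≤ F i) :
    ∑ B ∈ powersetCard (2 * L) (univ : Finset V), F #(A ∩ B) ≤
      ∑ i ∈ range (2 * L + 1), ((2 * L).choose i : ℝ) ^ 2 * F i := by
  have hmaps : ∀ B ∈ powersetCard (2 * L) (univ : Finset V), #(A ∩ B) ∈ range (2 * L + 1) := by
    intro B _
    have := card_le_card (inter_subset_left (s₁ := A) (s₂ := B))
    rw [mem_range]; omega
  rw [← sum_fiberwise_of_maps_to hmaps]
  refine sum_le_sum fun i _ => ?_
  calc _ = ∑ B ∈ powersetCard (2 * L) (univ : Finset V) with #(A ∩ B) = i, F i :=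
        sum_congr rfl fun B hB => by rw [(mem_filter.1 hB).2]
    _ = #{B ∈ powersetCard (2 * L) (univ : Finset V) | #(A ∩ B) = i} * F i := by simp
    _ ≤ _ := by
      gcongr
      · exact hF i
      · exact_mod_cast card_inter_eq_le hV hA i

lemma sum_sequences_mul {β : Type*} [Fintype β] {M : ℕ} (f g : β → ℝ) :
    ∑ p : (Fin M → β) × (Fin M → β), (∏ t, f (p.1 t)) * ∏ t, g (p.2 t) =
      (∑ τ, f τ) ^ M * (∑ τ, g τ) ^ M := by
  rw [Fintype.sum_pow, Fintype.sum_pow, sum_mul_sum, Fintype.sum_prod_type]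

/-- The version of `Separable` for sequences of tuples. -/
def TupleSeparable {k M : ℕ} (ω ω' : Fin M → Fin k → V) : Prop :=
  ∃ A : Finset V, (∀ t, ∃ i, ω t i ∈ A) ∧ ∀ t, ∃ i, ω' t i ∉ A

/-- The weighted number of balanced sets which separate two sequences of tuples. -/
noncomputable def weightedCount {k M : ℕ} (L : ℕ) (p : (Fin M → Fin k → V) × (Fin M → Fin k → V)) :
    ℝ :=
  ∑ A ∈ powersetCard (2 * L) (univ : Finset V),
    (∏ t, clauseWeight (sign A) (p.1 t)) * ∏ t, clauseWeight (-sign A) (p.2 t)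

lemma tupleSeparable_of_weightedCount_ne_zero {k M L : ℕ}
    {p : (Fin M → Fin k → V) × (Fin M → Fin k → V)} (h : weightedCount L p ≠ 0) :
    TupleSeparable p.1 p.2 := by
  obtain ⟨A, -, hA⟩ := exists_ne_zero_of_sum_ne_zero h
  refine ⟨A, fun t => ?_, fun t => ?_⟩
  · have h1 := prod_ne_zero_iff.1 (left_ne_zero_of_mul hA) t (mem_univ t)
    by_contra! hc
    exact h1 (clauseWeight_eq_zero fun i => by simp [sign, hc i])
  · have h1 := prod_ne_zero_iff.1 (right_ne_zero_of_mul hA) t (mem_univ t)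
    by_contra! hc
    exact h1 (clauseWeight_eq_zero fun i => by simp [sign, hc i])

lemma sum_weightedCount {k M L : ℕ} (hV : Fintype.card V = 4 * L) :
    ∑ p : (Fin M → Fin k → V) × (Fin M → Fin k → V), weightedCount L p =
      (4 * L).choose (2 * L) * (((4 * L : ℕ) : ℝ) ^ k * (binomTail k 1 / 2 ^ k)) ^ (2 * M) := by
  unfold weightedCount
  rw [sum_comm]
  have h : ∀ A ∈ powersetCard (2 * L) (univ : Finset V),
      ∑ p : (Fin M → Fin k → V) × (Fin M → Fin k → V),
        (∏ t, clauseWeight (sign A) (p.1 t)) * ∏ t, clauseWeight (-sign A) (p.2 t) =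
      (((4 * L : ℕ) : ℝ) ^ k * (binomTail k 1 / 2 ^ k)) ^ (2 * M) := by
    intro A hA
    have hs := sum_sign hV (mem_powersetCard.1 hA).2
    rw [sum_sequences_mul, sum_clauseWeight hs, sum_clauseWeight (by simp [hs]), hV]
    ring
  rw [sum_congr rfl h]
  simp [hV]

lemma sum_weightedCount_sq_le {k M L : ℕ} (hk : 4 ≤ k) (hL : 1 ≤ L)
    (hV : Fintype.card V = 4 * L) :
    ∑ p : (Fin M → Fin k → V) × (Fin M → Fin k → V), weightedCount L p ^ 2 ≤
      (4 * L).choose (2 * L) * ((((4 * L : ℕ) : ℝ) ^ k * (binomTail k 1 / 2 ^ k) ^ 2) ^ (2 * M) *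
        overlapSum k L M) := by
  have hK := binomTail_one_pos hk
  have hpair : ∀ A ∈ powersetCard (2 * L) (univ : Finset V),
      ∀ B ∈ powersetCard (2 * L) (univ : Finset V),
      ∑ p : (Fin M → Fin k → V) × (Fin M → Fin k → V),
        ((∏ t, clauseWeight (sign A) (p.1 t)) * ∏ t, clauseWeight (-sign A) (p.2 t)) *
        ((∏ t, clauseWeight (sign B) (p.1 t)) * ∏ t, clauseWeight (-sign B) (p.2 t)) =
      (((4 * L : ℕ) : ℝ) ^ k * (binomTail k 1 / 2 ^ k) ^ 2) ^ (2 * M) *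
        (1 + binomTail k ((#(A ∩ B) : ℝ) / L - 1) / binomTail k 1 ^ 2) ^ (2 * M) := by
    intro A hA B hB
    have hA := (mem_powersetCard.1 hA).2
    have hB := (mem_powersetCard.1 hB).2
    have hsA := sum_sign hV hA
    have hsB := sum_sign hV hB
    have hAB := sum_sign_mul_sign hL hV hA hB
    have hre (p : (Fin M → Fin k → V) × (Fin M → Fin k → V)) :
        ((∏ t, clauseWeight (sign A) (p.1 t)) * ∏ t, clauseWeight (-sign A) (p.2 t)) *
        ((∏ t, clauseWeight (sign B) (p.1 t)) * ∏ t, clauseWeight (-sign B) (p.2 t)) =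
        (∏ t, clauseWeight (sign A) (p.1 t) * clauseWeight (sign B) (p.1 t)) *
          ∏ t, clauseWeight (-sign A) (p.2 t) * clauseWeight (-sign B) (p.2 t) := by
      rw [prod_mul_distrib, prod_mul_distrib]; ring
    simp_rw [hre]
    rw [sum_sequences_mul (fun τ => clauseWeight (sign A) τ * clauseWeight (sign B) τ)
        (fun τ => clauseWeight (-sign A) τ * clauseWeight (-sign B) τ),
      sum_clauseWeight_mul hsA hsB hAB,
      sum_clauseWeight_mul (by simp [hsA]) (by simp [hsB]) (by simpa using hAB), hV, ← mul_pow, ← sq,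
      ← pow_mul, ← mul_pow]
    congr 1
    have h4 : (4 : ℝ) ^ k = (2 ^ k) ^ 2 := by rw [← pow_mul, mul_comm, pow_mul]; norm_num
    rw [h4]
    field_simp
  have hsq (p : (Fin M → Fin k → V) × (Fin M → Fin k → V)) : weightedCount L p ^ 2 =
      ∑ A ∈ powersetCard (2 * L) (univ : Finset V), ∑ B ∈ powersetCard (2 * L) (univ : Finset V),
        ((∏ t, clauseWeight (sign A) (p.1 t)) * ∏ t, clauseWeight (-sign A) (p.2 t)) *
        ((∏ t, clauseWeight (sign B) (p.1 t)) * ∏ t, clauseWeight (-sign B) (p.2 t)) := by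
    rw [sq, weightedCount, sum_mul_sum]
  simp_rw [hsq]
  rw [sum_comm]
  have hcard : (#(powersetCard (2 * L) (univ : Finset V)) : ℝ) = (4 * L).choose (2 * L) := by
    rw [card_powersetCard, card_univ, hV]
  rw [← hcard, ← nsmul_eq_mul, ← sum_const]
  refine sum_le_sum fun A hA => ?_
  rw [sum_comm, sum_congr rfl (hpair A hA), ← mul_sum]
  gcongr
  exact sum_overlap_le hV (mem_powersetCard.1 hA).2
    (F := fun i => (1 + binomTail k ((i : ℝ) / L - 1) / binomTail k 1 ^ 2) ^ (2 * M))
    fun i => (even_two_mul M).pow_nonneg _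

open Classical in
/-- The second moment method: if the overlap sum is bounded, two sequences of `M` independent uniform
tuples are separable with probability at least `1 / 157`. -/
lemma card_tupleSeparable_ge {k M L : ℕ} (hk : 4 ≤ k) (hL : 1 ≤ L) (hV : Fintype.card V = 4 * L)
    (hS : overlapSum k L M ≤ 157 * (4 * L).choose (2 * L)) :
    (Fintype.card (Fin M → Fin k → V) : ℝ) ^ 2 ≤
      157 * #{p : (Fin M → Fin k → V) × (Fin M → Fin k → V) | TupleSeparable p.1 p.2} := by
  have hK := binomTail_one_pos hk
  set D := ({p : (Fin M → Fin k → V) × (Fin M → Fin k → V) | TupleSeparable p.1 p.2} : Finset _)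
    with hD
  set N : ℝ := ((4 * L : ℕ) : ℝ) with hN
  have hN0 : 0 < N := by rw [hN]; exact_mod_cast (by omega : 0 < 4 * L)
  set b : ℝ := ((4 * L).choose (2 * L) : ℝ) with hb
  have hb0 : 0 < b := by rw [hb]; exact_mod_cast Nat.choose_pos (by omega)
  have hcs := sum_mul_sq_le_sq_mul_sq D (fun _ => (1 : ℝ))
    (fun p : (Fin M → Fin k → V) × (Fin M → Fin k → V) => weightedCount L p)
  have hsupp : ∑ p ∈ D, weightedCount L p =
      ∑ p : (Fin M → Fin k → V) × (Fin M → Fin k → V), weightedCount L p := by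
    refine sum_subset (subset_univ _) fun p _ hp => ?_
    by_contra h
    exact hp (mem_filter.2 ⟨mem_univ _, tupleSeparable_of_weightedCount_ne_zero h⟩)
  have hsq : ∑ p ∈ D, weightedCount L p ^ 2 ≤
      ∑ p : (Fin M → Fin k → V) × (Fin M → Fin k → V), weightedCount L p ^ 2 :=
    sum_le_sum_of_subset_of_nonneg (subset_univ _) fun _ _ _ => sq_nonneg _
  have h2 := hsq.trans (sum_weightedCount_sq_le hk hL hV)
  simp only [one_mul, one_pow, sum_const, nsmul_eq_mul, mul_one] at hcs
  rw [hsupp, sum_weightedCount hV] at hcs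
  set κ : ℝ := binomTail k 1 / 2 ^ k with hκ
  have hκ0 : 0 < κ := by positivity
  have h3 : (b * (N ^ k * κ) ^ (2 * M)) ^ 2 ≤
      #D * (b * ((N ^ k * κ ^ 2) ^ (2 * M) * (157 * b))) := by
    refine hcs.trans ?_
    gcongr
    refine h2.trans ?_
    gcongr
  have hcard : (Fintype.card (Fin M → Fin k → V) : ℝ) = (N ^ k) ^ M := by
    rw [Fintype.card_fun, Fintype.card_fun, Fintype.card_fin, Fintype.card_fin, hV]
    push_cast [hN]; rfl
  rw [hcard]
  have hpos : 0 < b ^ 2 * (N ^ k * κ ^ 2) ^ (2 * M) := by positivity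
  refine le_of_mul_le_mul_left ?_ hpos
  calc _ = (b * (N ^ k * κ) ^ (2 * M)) ^ 2 := by
        simp only [mul_pow, ← pow_mul]; ring
    _ ≤ _ := h3
    _ = _ := by ring

end SecondMoment

/-! ### From independent tuples to uniform edge sets -/

section Monotone

variable {α : Type*} [Fintype α] [DecidableEq α]

/-- Local LYM: the proportion of `r`-sets in a family closed under taking subsets is antitone. -/
lemma slice_div_choose_antitone (D : Finset α → Prop) [DecidablePred D]
    (hD : ∀ S T, S ⊆ T → D T → D S) {m r : ℕ} (hmr : m ≤ r) :
    (#{S ∈ powersetCard r (univ : Finset α) | D S} : ℝ) / (Fintype.card α).choose r ≤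
      (#{S ∈ powersetCard m (univ : Finset α) | D S} : ℝ) / (Fintype.card α).choose m := by
  induction r, hmr using Nat.le_induction with
  | base => exact le_rfl
  | succ r _ ih =>
    refine le_trans ?_ ih
    have hsized : ({S ∈ powersetCard (r + 1) (univ : Finset α) | D S} : Set (Finset α)).Sized
        (r + 1) := fun S hS => (mem_powersetCard.1 hS.1).2
    have h := local_lubell_yamamoto_meshalkin_inequality_div (𝕜 := ℝ)
      (𝒜 := {S ∈ powersetCard (r + 1) (univ : Finset α) | D S}) (Nat.succ_ne_zero r)
      (by simpa using hsized)
    refine h.trans ?_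
    rw [Nat.succ_sub_one]
    gcongr
    intro S hS
    obtain ⟨T, hT, a, ha, rfl⟩ := mem_shadow_iff.1 hS
    obtain ⟨hT1, hT2⟩ := mem_filter.1 hT
    refine mem_filter.2 ⟨mem_powersetCard.2 ⟨subset_univ _, ?_⟩, hD _ _ (erase_subset _ _) hT2⟩
    rw [card_erase_of_mem ha, (mem_powersetCard.1 hT1).2, Nat.add_sub_cancel]

end Monotone

section Sampling

lemma card_related_mem {α β : Type*} [Fintype β] [DecidableEq β] {rel : β → α → Prop}
    [DecidableRel rel] (huniq : ∀ x a b, rel x a → rel x b → a = b) {d : ℕ}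
    (hd : ∀ a, #{x | rel x a} = d)
    (S : Finset α) : #{x | ∃ a ∈ S, rel x a} = d * #S := by
  have h : ({x | ∃ a ∈ S, rel x a} : Finset β) = S.biUnion fun a => {x | rel x a} := by
    ext x; simp
  rw [h, card_biUnion]
  · simp [hd, mul_comm]
  · intro a _ b _ hab
    refine disjoint_left.2 fun x hx hy => hab ?_
    exact huniq x a b (by simpa using hx) (by simpa using hy)

variable {α β : Type*} [Fintype α]

/-- The elements of `α` represented by some term of the sequence `ω`. -/
def sampled (rel : β → α → Prop) [DecidableRel rel] {M : ℕ} (ω : Fin M → β) : Finset α := {a | ∃ t, rel (ω t) a}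

lemma mem_sampled {rel : β → α → Prop} [DecidableRel rel] {M : ℕ} {ω : Fin M → β} {a : α} :
    a ∈ sampled rel ω ↔ ∃ t, rel (ω t) a := by
  simp [sampled]

variable [Fintype β] [DecidableEq α] [DecidableEq β] {rel : β → α → Prop} [DecidableRel rel]

lemma card_sampled_subset (huniq : ∀ x a b, rel x a → rel x b → a = b) {d : ℕ}
    (hd : ∀ a, #{x | rel x a} = d)
    (M : ℕ) (S : Finset α) :
    #{ω : Fin M → β | sampled rel ω ⊆ S} =
      (#{x | ∀ a, ¬ rel x a} + d * #S) ^ M := by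
  have h1 : #{x | ∀ a, rel x a → a ∈ S} = #{x | ∀ a, ¬ rel x a} + d * #S := by
    rw [← card_related_mem huniq hd S, ← card_union_of_disjoint]
    · congr 1
      ext x
      simp only [mem_filter, mem_univ, true_and, mem_union]
      constructor
      · intro h
        by_cases h' : ∀ a, ¬ rel x a
        · exact .inl h'
        · push Not at h'
          obtain ⟨a, ha⟩ := h'
          exact .inr ⟨a, h a ha, ha⟩
      · rintro (h | ⟨a, ha, hx⟩) b hb
        · exact absurd hb (h b)
        · exact huniq x a b hx hb ▸ ha
    · refine disjoint_left.2 fun x hx hy => ?_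
      simp only [mem_filter, mem_univ, true_and] at hx hy
      obtain ⟨a, -, ha⟩ := hy
      exact hx a ha
  have h2 : ({ω : Fin M → β | sampled rel ω ⊆ S} : Finset (Fin M → β)) =
      Fintype.piFinset fun _ => {x | ∀ a, rel x a → a ∈ S} := by
    ext ω
    simp only [mem_filter, mem_univ, true_and, Fintype.mem_piFinset, Finset.subset_iff, mem_sampled]
    exact ⟨fun h t a ha => h ⟨t, ha⟩, fun h a ⟨t, ha⟩ => h t a ha⟩
  rw [h2, Fintype.card_piFinset]
  simp [h1]

/-- By inclusion and exclusion, all sets of the same size are equally likely to be sampled. -/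
lemma exists_card_sampled_eq (huniq : ∀ x a b, rel x a → rel x b → a = b) {d : ℕ}
    (hd : ∀ a, #{x | rel x a} = d)
    (M : ℕ) :
    ∃ F : ℕ → ℕ, ∀ S : Finset α, #{ω : Fin M → β | sampled rel ω = S} = F #S := by
  classical
  set c : Finset α → ℕ := fun S => #{ω : Fin M → β | sampled rel ω = S} with hc
  suffices h : ∀ n, ∀ S S' : Finset α, #S = n → #S' = n → c S = c S' by
    refine ⟨fun n => if h : ∃ S : Finset α, #S = n then c h.choose else 0, fun S => ?_⟩
    have hex : ∃ T : Finset α, #T = #S := ⟨S, rfl⟩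
    simp only [dif_pos hex]
    exact h _ _ _ rfl hex.choose_spec
  intro n
  induction n using Nat.strong_induction_on with
  | _ n ih =>
    set f : ℕ → ℕ := fun j =>
      if h : j < n ∧ ∃ S : Finset α, #S = j then c h.2.choose else 0 with hf
    have key : ∀ S : Finset α, #S = n → (#{x | ∀ a, ¬ rel x a} + d * n) ^ M =
        c S + ∑ j ∈ range (n + 1), n.choose j * f j := by
      intro S hS
      have h1 : #{ω : Fin M → β | sampled rel ω ⊆ S} = ∑ T ∈ S.powerset, c T := by
        rw [card_eq_sum_card_fiberwise (f := fun ω => sampled rel ω) (t := S.powerset)]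
        · refine sum_congr rfl fun T hT => ?_
          simp only [hc]
          congr 1
          ext ω
          simp only [mem_filter, mem_univ, true_and, and_iff_right_iff_imp]
          rintro rfl
          exact mem_powerset.1 hT
        · intro ω hω
          simpa using hω
      have h2 : ∀ T ∈ S.powerset.erase S, c T = f #T := by
        intro T hT
        obtain ⟨hne, hsub⟩ := mem_erase.1 hT
        have hlt : #T < n := by
          rw [← hS]
          exact card_lt_card ((mem_powerset.1 hsub).ssubset_of_ne hne)
        have hex : #T < n ∧ ∃ S : Finset α, #S = #T := ⟨hlt, T, rfl⟩
        simp only [hf, dif_pos hex]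
        exact ih _ hlt _ _ rfl hex.2.choose_spec
      have h3 : f #S = 0 := by simp [hf, hS]
      have h4 := sum_powerset_apply_card f (x := S)
      rw [hS] at h4
      simp only [smul_eq_mul] at h4
      rw [← hS, ← card_sampled_subset huniq hd, h1, hS, ← h4,
        ← add_sum_erase _ _ (mem_powerset_self S), sum_congr rfl h2,
        ← add_sum_erase _ (fun T => f #T) (mem_powerset_self S), h3, zero_add]
    intro S S' hS hS'
    have := (key S hS).symm.trans (key S' hS')
    omega

/-- Sampling at least `m` elements is harder for a family closed under subsets than a uniformly
random set of exactly `m` elements. -/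
lemma card_sampled_mem_le (huniq : ∀ x a b, rel x a → rel x b → a = b) {d : ℕ}
    (hd : ∀ a, #{x | rel x a} = d)
    (M m : ℕ) (D : Finset α → Prop) [DecidablePred D]
    (hD : ∀ S T, S ⊆ T → D T → D S) :
    (#{ω : Fin M → β | D (sampled rel ω)} : ℝ) ≤
      Fintype.card (Fin M → β) * ((#{S ∈ powersetCard m (univ : Finset α) | D S} : ℝ) /
        (Fintype.card α).choose m) + #{ω : Fin M → β | #(sampled rel ω) < m} := by
  obtain ⟨F, hF⟩ := exists_card_sampled_eq huniq hd M
  set q : ℝ := (#{S ∈ powersetCard m (univ : Finset α) | D S} : ℝ) /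
        (Fintype.card α).choose m with hq
  have hq0 : 0 ≤ q := by positivity
  have hlevel (D' : Finset α → Prop) [DecidablePred D'] (r : ℕ) :
      #{ω : Fin M → β | D' (sampled rel ω) ∧ #(sampled rel ω) = r} =
        #{S ∈ powersetCard r (univ : Finset α) | D' S} * F r := by
    rw [card_eq_sum_card_fiberwise (f := fun ω => sampled rel ω)
      (t := {S ∈ powersetCard r (univ : Finset α) | D' S})]
    · rw [← smul_eq_mul, ← sum_const]
      refine sum_congr rfl fun S hS => ?_
      obtain ⟨hS1, hS2⟩ := mem_filter.1 hS
      have hS1 := (mem_powersetCard.1 hS1).2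
      rw [← hS1, ← hF S]
      congr 1
      ext ω
      simp only [mem_filter, mem_univ, true_and, and_iff_right_iff_imp]
      rintro rfl
      exact ⟨hS2, rfl⟩
    · intro ω hω
      simp only [coe_filter, mem_univ, true_and, Set.mem_ofPred_eq] at hω
      simp [mem_powersetCard, hω.1, hω.2]
  have hr (r : ℕ) (hmr : m ≤ r) :
      (#{ω : Fin M → β | D (sampled rel ω) ∧ #(sampled rel ω) = r} : ℝ) ≤
        q * #{ω : Fin M → β | #(sampled rel ω) = r} := by
    have h1 := hlevel D r
    have h2 := hlevel (fun _ => True) r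
    simp only [true_and, filter_true, card_powersetCard, card_univ] at h2
    rw [h1, h2]
    push_cast
    rw [← mul_assoc]
    gcongr
    rcases Nat.eq_zero_or_pos ((Fintype.card α).choose r) with h0 | h0
    · have : #{S ∈ powersetCard r (univ : Finset α) | D S} ≤ (Fintype.card α).choose r := by
        refine (card_filter_le _ _).trans ?_
        rw [card_powersetCard, card_univ]
      rw [h0] at this
      rw [h0, Nat.le_zero.1 this]
      simp
    · have h3 := slice_div_choose_antitone D hD hmr
      rwa [div_le_iff₀ (by exact_mod_cast h0)] at h3
  have hmaps (P : (Fin M → β) → Prop) [DecidablePred P] :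
      #{ω : Fin M → β | P ω ∧ m ≤ #(sampled rel ω)} =
        ∑ r ∈ Icc m (Fintype.card α), #{ω : Fin M → β | P ω ∧ #(sampled rel ω) = r} := by
    rw [card_eq_sum_card_fiberwise (f := fun ω => #(sampled rel ω))
      (t := Icc m (Fintype.card α))]
    · refine sum_congr rfl fun r hr => ?_
      congr 1
      ext ω
      simp only [mem_filter, mem_univ, true_and]
      have := (mem_Icc.1 hr).1
      constructor
      · rintro ⟨⟨h, -⟩, h'⟩; exact ⟨h, h'⟩
      · rintro ⟨h, h'⟩; exact ⟨⟨h, by omega⟩, h'⟩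
    · intro ω hω
      simp only [coe_filter, mem_univ, true_and, Set.mem_ofPred_eq] at hω
      simpa using ⟨hω.2, card_le_univ _⟩
  have hlarge : (#{ω : Fin M → β | D (sampled rel ω) ∧ m ≤ #(sampled rel ω)} : ℝ) ≤
      q * Fintype.card (Fin M → β) := by
    rw [hmaps fun ω => D (sampled rel ω)]
    push_cast
    calc _ ≤ ∑ r ∈ Icc m (Fintype.card α), q * #{ω : Fin M → β | #(sampled rel ω) = r} :=
          sum_le_sum fun r h => hr r (mem_Icc.1 h).1
      _ = q * #{ω : Fin M → β | m ≤ #(sampled rel ω)} := by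
          have h := hmaps fun _ => True
          simp only [true_and] at h
          rw [← mul_sum, h]
          push_cast; rfl
      _ ≤ _ := by
          gcongr
          exact card_le_univ _
  have hsplit : #{ω : Fin M → β | D (sampled rel ω)} ≤
      #{ω : Fin M → β | D (sampled rel ω) ∧ m ≤ #(sampled rel ω)} +
        #{ω : Fin M → β | #(sampled rel ω) < m} := by
    refine (card_le_card fun ω hω => ?_).trans (card_union_le _ _)
    simp only [mem_filter, mem_univ, true_and, mem_union] at hω ⊢
    rcases lt_or_ge #(sampled rel ω) m with h | h
    · exact .inr h
    · exact .inl ⟨hω, h⟩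
  have hsplit' : (#{ω : Fin M → β | D (sampled rel ω)} : ℝ) ≤
      #{ω : Fin M → β | D (sampled rel ω) ∧ m ≤ #(sampled rel ω)} +
        #{ω : Fin M → β | #(sampled rel ω) < m} := by exact_mod_cast hsplit
  linarith

open Classical in
/-- The comparison for pairs, applied to one coordinate at a time. -/
lemma card_sampled_pair_le (huniq : ∀ x a b, rel x a → rel x b → a = b) {d : ℕ}
    (hd : ∀ a, #{x | rel x a} = d)
    (M m : ℕ) (D : Finset α → Finset α → Prop)
    (hD : ∀ S S' T T', S ⊆ S' → T ⊆ T' → D S' T' → D S T) :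
    (#{p : (Fin M → β) × (Fin M → β) | D (sampled rel p.1) (sampled rel p.2)} : ℝ) ≤
      (Fintype.card (Fin M → β) : ℝ) ^ 2 *
        ((#{p ∈ powersetCard m (univ : Finset α) ×ˢ powersetCard m univ | D p.1 p.2} : ℝ) /
          ((Fintype.card α).choose m : ℝ) ^ 2) +
      2 * Fintype.card (Fin M → β) * #{ω : Fin M → β | #(sampled rel ω) < m} := by
  set Ω : ℝ := (Fintype.card (Fin M → β) : ℝ) with hΩ
  set c : ℝ := ((Fintype.card α).choose m : ℝ) with hc
  set ε : ℝ := (#{ω : Fin M → β | #(sampled rel ω) < m} : ℝ) with hε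
  set P := powersetCard m (univ : Finset α) with hP
  have hcP : (#P : ℝ) = c := by rw [hP, card_powersetCard, card_univ]
  have h1 (T : Finset α) := card_sampled_mem_le huniq hd M m (fun S => D S T)
    fun S S' h => hD S S' T T h Subset.rfl
  have h2 (S : Finset α) := card_sampled_mem_le huniq hd M m (fun T => D S T)
    fun T T' h => hD S S T T' Subset.rfl h
  have hswap : ∑ ω' : Fin M → β, (#{S ∈ P | D S (sampled rel ω')} : ℝ) =
      ∑ S ∈ P, (#{ω' : Fin M → β | D S (sampled rel ω')} : ℝ) := by
    simp only [card_filter]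
    push_cast
    exact sum_comm
  have hpair : (#{p : (Fin M → β) × (Fin M → β) | D (sampled rel p.1) (sampled rel p.2)} : ℝ) =
      ∑ ω' : Fin M → β, (#{ω : Fin M → β | D (sampled rel ω) (sampled rel ω')} : ℝ) := by
    simp only [card_filter]
    push_cast
    rw [Fintype.sum_prod_type, sum_comm]
  have hpair' : (#{p ∈ P ×ˢ P | D p.1 p.2} : ℝ) = ∑ S ∈ P, (#{T ∈ P | D S T} : ℝ) := by
    simp only [card_filter]
    push_cast
    rw [sum_product]
  have hε0 : 0 ≤ ε := by positivity
  have hc0 : 0 ≤ c := by positivity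
  have hΩ0 : 0 ≤ Ω := by positivity
  rw [hpair, hpair']
  calc _ ≤ ∑ ω' : Fin M → β, (Ω * ((#{S ∈ P | D S (sampled rel ω')} : ℝ) / c) + ε) :=
        sum_le_sum fun ω' _ => h1 _
    _ = Ω / c * ∑ S ∈ P, (#{ω' : Fin M → β | D S (sampled rel ω')} : ℝ) + Ω * ε := by
        rw [sum_add_distrib, ← hswap, mul_sum, sum_const, card_univ, nsmul_eq_mul]
        congr 1
        exact sum_congr rfl fun _ _ => by ring
    _ ≤ Ω / c * ∑ S ∈ P, (Ω * ((#{T ∈ P | D S T} : ℝ) / c) + ε) + Ω * ε := by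
        gcongr with S hS
        exact h2 S
    _ = Ω ^ 2 * ((∑ S ∈ P, (#{T ∈ P | D S T} : ℝ)) / c ^ 2) + Ω * ε * (c / c) + Ω * ε := by
        rw [sum_add_distrib, sum_const, nsmul_eq_mul, hcP, ← mul_sum, ← sum_div]
        ring
    _ ≤ _ := by
        have : Ω * ε * (c / c) ≤ Ω * ε * 1 := by gcongr; exact div_self_le_one c
        linarith

end Sampling

/-! ### Few samples are lost -/

section Loss

variable {α β : Type*} [Fintype α] {rel : β → α → Prop} [DecidableRel rel]

/-- A bound for the number of indices which contribute no new element: those which represent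
nothing, and the pairs of indices which represent the same element. -/
def lossBound (rel : β → α → Prop) [DecidableRel rel] {M : ℕ} (ω : Fin M → β) : ℕ :=
  #{t | ∀ a, ¬ rel (ω t) a} +
    #{p : Fin M × Fin M | p.1 ≠ p.2 ∧ ∃ a, rel (ω p.1) a ∧ rel (ω p.2) a}

lemma le_card_sampled_add_lossBound {M : ℕ} (ω : Fin M → β) :
    M ≤ #(sampled rel ω) + lossBound rel ω := by
  classical
  set T : Finset (Fin M) := {t | (∃ a, rel (ω t) a) ∧ ∀ s < t, ¬ ∃ a, rel (ω s) a ∧ rel (ω t) a}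
    with hT
  have h1 : #T ≤ #(sampled rel ω) := by
    have hex : ∀ t ∈ T, ∃ a, rel (ω t) a := fun t ht => (mem_filter.1 ht).2.1
    rcases T.eq_empty_or_nonempty with hT0 | ⟨t₀, ht₀⟩
    · simp [hT0]
    have : Nonempty α := (hex t₀ ht₀).nonempty
    choose! f hf using hex
    refine card_le_card_of_injOn f (fun t ht => mem_sampled.2 ⟨t, hf t ht⟩) ?_
    intro s hs t ht hst
    have hs2 := (mem_filter.1 hs).2.2
    have ht2 := (mem_filter.1 ht).2.2
    rcases lt_trichotomy s t with h | h | h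
    · exact absurd ⟨f s, hf s hs, hst ▸ hf t ht⟩ (ht2 s h)
    · exact h
    · exact absurd ⟨f t, hf t ht, hst ▸ hf s hs⟩ (hs2 t h)
  have h2 : #Tᶜ ≤ lossBound rel ω := by
    have hsub : Tᶜ ⊆ ({t | ∀ a, ¬ rel (ω t) a} : Finset (Fin M)) ∪
        ({p : Fin M × Fin M | p.1 ≠ p.2 ∧ ∃ a, rel (ω p.1) a ∧ rel (ω p.2) a} :
          Finset (Fin M × Fin M)).image Prod.snd := by
      intro t ht
      simp only [hT, mem_compl, mem_filter, mem_univ, true_and, not_and_or] at ht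
      rw [mem_union, mem_image]
      rcases ht with h | h
      · left; simpa using h
      · right
        push Not at h
        obtain ⟨s, hs, a, ha⟩ := h
        exact ⟨(s, t), by simpa using ⟨hs.ne, a, ha⟩, rfl⟩
    refine (card_le_card hsub).trans ((card_union_le _ _).trans ?_)
    exact Nat.add_le_add_left card_image_le _
  have h3 := card_add_card_compl T
  rw [Fintype.card_fin] at h3
  omega

variable [Fintype β] [DecidableEq β]

lemma card_apply_mem (hβ : 0 < Fintype.card β) {M : ℕ} (Z : Finset β) (t : Fin M) :
    (#{ω : Fin M → β | ω t ∈ Z} : ℝ) =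
      Fintype.card (Fin M → β) * ((#Z : ℝ) / Fintype.card β) := by
  have hb : (Fintype.card β : ℝ) ≠ 0 := by positivity
  have h : ({ω : Fin M → β | ω t ∈ Z} : Finset (Fin M → β)) =
      Fintype.piFinset fun s => if s = t then Z else univ := by
    ext ω
    simp only [mem_filter, mem_univ, true_and, Fintype.mem_piFinset]
    constructor
    · intro h s
      split_ifs with hs
      · exact hs ▸ h
      · exact mem_univ _
    · intro h
      simpa using h t
  have h2 (s : Fin M) : (#(if s = t then Z else univ) : ℝ) =
      Fintype.card β * if s = t then (#Z : ℝ) / Fintype.card β else 1 := by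
    split_ifs
    · field_simp
    · simp
  rw [h, Fintype.card_piFinset]
  push_cast
  simp_rw [h2]
  rw [prod_mul_distrib]
  simp

lemma card_apply_mem_and_apply_mem (hβ : 0 < Fintype.card β) {M : ℕ} (Z : Finset β) {i j : Fin M}
    (hij : i ≠ j) :
    (#{ω : Fin M → β | ω i ∈ Z ∧ ω j ∈ Z} : ℝ) =
      Fintype.card (Fin M → β) * ((#Z : ℝ) / Fintype.card β) ^ 2 := by
  have hb : (Fintype.card β : ℝ) ≠ 0 := by positivity
  have h : ({ω : Fin M → β | ω i ∈ Z ∧ ω j ∈ Z} : Finset (Fin M → β)) =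
      Fintype.piFinset fun s => if s = i ∨ s = j then Z else univ := by
    ext ω
    simp only [mem_filter, mem_univ, true_and, Fintype.mem_piFinset]
    constructor
    · intro h s
      split_ifs with hs
      · rcases hs with rfl | rfl
        exacts [h.1, h.2]
      · exact mem_univ _
    · intro h
      exact ⟨by simpa using h i, by simpa using h j⟩
  have h2 (s : Fin M) : (#(if s = i ∨ s = j then Z else univ) : ℝ) =
      Fintype.card β * ((if s = i then (#Z : ℝ) / Fintype.card β else 1) *
        if s = j then (#Z : ℝ) / Fintype.card β else 1) := by
    by_cases h1 : s = i
    · have : s ≠ j := fun h => hij (h1 ▸ h)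
      simp only [h1, hij, true_or, if_true, if_false]
      field_simp
    · by_cases h2 : s = j
      · simp only [h2, hij.symm, or_true, if_true, if_false]
        field_simp
      · simp [h1, h2]
  rw [h, Fintype.card_piFinset]
  push_cast
  simp_rw [h2]
  rw [prod_mul_distrib, prod_mul_distrib]
  simp [sq]

lemma sum_lossBound_le (huniq : ∀ x a b, rel x a → rel x b → a = b) {d : ℕ}
    (hd : ∀ a, #{x | rel x a} = d) (hβ : 0 < Fintype.card β) (M : ℕ) :
    ∑ ω : Fin M → β, (lossBound rel ω : ℝ) ≤ Fintype.card (Fin M → β) *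
      (M * ((#{x | ∀ a, ¬ rel x a} : ℝ) / Fintype.card β) +
        M ^ 2 * ((d : ℝ) / Fintype.card β)) := by
  have hb : (0 : ℝ) < Fintype.card β := by exact_mod_cast hβ
  set Ω : ℝ := (Fintype.card (Fin M → β) : ℝ) with hΩ
  have hΩ0 : 0 ≤ Ω := by positivity
  have h1 : ∑ ω : Fin M → β, (#{t | ∀ a, ¬ rel (ω t) a} : ℝ) =
      Ω * (M * ((#{x | ∀ a, ¬ rel x a} : ℝ) / Fintype.card β)) := by
    have hswap : ∑ ω : Fin M → β, (#{t | ∀ a, ¬ rel (ω t) a} : ℝ) =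
        ∑ t : Fin M, (#{ω : Fin M → β | ω t ∈ ({x | ∀ a, ¬ rel x a} : Finset β)} : ℝ) := by
      simp only [card_filter, mem_filter, mem_univ, true_and]
      push_cast
      exact sum_comm
    rw [hswap]
    simp_rw [card_apply_mem hβ]
    rw [sum_const, card_univ, Fintype.card_fin, nsmul_eq_mul]
    ring
  have hcoll (i j : Fin M) (hij : i ≠ j) :
      (#{ω : Fin M → β | ∃ a, rel (ω i) a ∧ rel (ω j) a} : ℝ) ≤
        Ω * ((d : ℝ) / Fintype.card β) := by
    have hsub : ({ω : Fin M → β | ∃ a, rel (ω i) a ∧ rel (ω j) a} : Finset (Fin M → β)) ⊆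
        (univ : Finset α).biUnion fun a =>
          {ω : Fin M → β | ω i ∈ ({x | rel x a} : Finset β) ∧
            ω j ∈ ({x | rel x a} : Finset β)} := by
      intro ω hω
      simpa using hω
    have h := (card_le_card hsub).trans card_biUnion_le
    have hdα : d * Fintype.card α ≤ Fintype.card β := by
      rw [← card_univ, ← card_related_mem huniq hd]
      exact card_le_univ _
    have hdα' : (d : ℝ) * Fintype.card α / Fintype.card β ≤ 1 := by
      rw [div_le_one hb]; exact_mod_cast hdα
    calc (#{ω : Fin M → β | ∃ a, rel (ω i) a ∧ rel (ω j) a} : ℝ)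
        ≤ ∑ a : α, (#{ω : Fin M → β | ω i ∈ ({x | rel x a} : Finset β) ∧
            ω j ∈ ({x | rel x a} : Finset β)} : ℝ) := by exact_mod_cast h
      _ = Fintype.card α * (Ω * ((d : ℝ) / Fintype.card β) ^ 2) := by
        simp_rw [card_apply_mem_and_apply_mem hβ _ hij, hd]
        rw [sum_const, card_univ, nsmul_eq_mul]
      _ = Ω * ((d : ℝ) / Fintype.card β) * ((d : ℝ) * Fintype.card α / Fintype.card β) := by ring
      _ ≤ Ω * ((d : ℝ) / Fintype.card β) * 1 := by gcongr
      _ = _ := mul_one _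
  have h2 : ∑ ω : Fin M → β,
      (#{p : Fin M × Fin M | p.1 ≠ p.2 ∧ ∃ a, rel (ω p.1) a ∧ rel (ω p.2) a} : ℝ) ≤
      Ω * (M ^ 2 * ((d : ℝ) / Fintype.card β)) := by
    have hswap : ∑ ω : Fin M → β,
        (#{p : Fin M × Fin M | p.1 ≠ p.2 ∧ ∃ a, rel (ω p.1) a ∧ rel (ω p.2) a} : ℝ) =
        ∑ p : Fin M × Fin M,
          (#{ω : Fin M → β | p.1 ≠ p.2 ∧ ∃ a, rel (ω p.1) a ∧ rel (ω p.2) a} : ℝ) := by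
      simp only [card_filter]
      push_cast
      exact sum_comm
    rw [hswap]
    calc _ ≤ ∑ _p : Fin M × Fin M, Ω * ((d : ℝ) / Fintype.card β) := by
          refine sum_le_sum fun p _ => ?_
          by_cases hp : p.1 = p.2
          · simp only [hp, ne_eq, not_true_eq_false, false_and, filter_false, card_empty,
              Nat.cast_zero]
            positivity
          · simpa [hp] using hcoll p.1 p.2 hp
      _ = _ := by
          rw [sum_const, card_univ, Fintype.card_prod, Fintype.card_fin, nsmul_eq_mul]
          push_cast; ring
  simp only [lossBound]
  push_cast
  rw [sum_add_distrib, mul_add]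
  exact add_le_add h1.le h2

/-- Markov's inequality for the number of lost samples. -/
lemma card_sampled_lt_le (huniq : ∀ x a b, rel x a → rel x b → a = b) {d : ℕ}
    (hd : ∀ a, #{x | rel x a} = d) (hβ : 0 < Fintype.card β) (M m : ℕ) :
    (#{ω : Fin M → β | #(sampled rel ω) < m} : ℝ) * (M - m) ≤ Fintype.card (Fin M → β) *
      (M * ((#{x | ∀ a, ¬ rel x a} : ℝ) / Fintype.card β) +
        M ^ 2 * ((d : ℝ) / Fintype.card β)) := by
  refine le_trans ?_ (sum_lossBound_le huniq hd hβ M)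
  calc (#{ω : Fin M → β | #(sampled rel ω) < m} : ℝ) * (M - m)
      = ∑ ω : Fin M → β with #(sampled rel ω) < m, ((M : ℝ) - m) := by
        rw [sum_const, nsmul_eq_mul]
    _ ≤ ∑ ω : Fin M → β with #(sampled rel ω) < m, (lossBound rel ω : ℝ) := by
        refine sum_le_sum fun ω hω => ?_
        have h1 := (mem_filter.1 hω).2
        have h2 := le_card_sampled_add_lossBound (rel := rel) ω
        have h3 : M ≤ m + lossBound rel ω := by omega
        have h4 : (M : ℝ) ≤ m + lossBound rel ω := by exact_mod_cast h3
        linarith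
    _ ≤ _ := sum_le_sum_of_subset_of_nonneg (subset_univ _) fun _ _ _ => by positivity

end Loss

/-! ### Tuples as edges -/

section Tuples

variable {n k N : ℕ}

/-- The tuple `τ` lists the vertices of the edge `e` without repetition. The vertex set `[N]` of the
tuples may be larger than `[n]`; tuples that leave `[n]` represent no edge. -/
def Lists (h : n ≤ N) (τ : Fin k → Fin N) (e : Edge n k) : Prop :=
  Function.Injective τ ∧ ∀ i, ∃ v ∈ e.1, Fin.castLE h v = τ i

lemma Lists.mem_iff {h : n ≤ N} {τ : Fin k → Fin N} {e : Edge n k} (he : Lists h τ e) (v : Fin n) :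
    v ∈ e.1 ↔ ∃ i, Fin.castLE h v = τ i := by
  classical
  choose f hf hfτ using he.2
  have hinj : Function.Injective f := fun i j hij => he.1 (by rw [← hfτ, ← hfτ, hij])
  have himg : univ.image f = e.1 := by
    refine eq_of_subset_of_card_le (fun v hv => ?_) ?_
    · obtain ⟨i, -, rfl⟩ := mem_image.1 hv
      exact hf i
    · rw [card_image_of_injective _ hinj, e.2, card_univ, Fintype.card_fin]
  rw [← himg, mem_image]
  constructor
  · rintro ⟨i, -, rfl⟩
    exact ⟨i, hfτ i⟩
  · rintro ⟨i, hi⟩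
    exact ⟨i, mem_univ _, Fin.castLE_injective h ((hfτ i).trans hi.symm)⟩

lemma Lists.unique (h : n ≤ N) (τ : Fin k → Fin N) (e e' : Edge n k) (he : Lists h τ e)
    (he' : Lists h τ e') : e = e' := by
  ext v
  rw [he.mem_iff, he'.mem_iff]

open Classical in
lemma card_lists (h : n ≤ N) (e : Edge n k) : #{τ | Lists h τ e} = k.factorial := by
  have hcard : Fintype.card (Fin k ↪ e.1) = k.factorial := by
    rw [Fintype.card_embedding_eq, Fintype.card_coe, e.2, Fintype.card_fin, Nat.descFactorial_self]
  rw [← hcard, ← card_univ]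
  symm
  refine card_bij (fun f _ i => Fin.castLE h (f i).1) ?_ ?_ ?_
  · intro f _
    refine mem_filter.2 ⟨mem_univ _, fun i j hij => ?_, fun i => ⟨_, (f i).2, rfl⟩⟩
    exact f.injective (Subtype.ext (Fin.castLE_injective h hij))
  · intro f _ g _ hfg
    ext1 i
    exact Subtype.ext (Fin.castLE_injective h (congrFun hfg i))
  · intro τ hτ
    obtain ⟨hinj, hmem⟩ := (mem_filter.1 hτ).2
    choose f hf hfτ using hmem
    refine ⟨⟨fun i => ⟨f i, hf i⟩, fun i j hij => hinj ?_⟩, mem_univ _, funext hfτ⟩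
    have hfij : f i = f j := congrArg Subtype.val hij
    rw [← hfτ, ← hfτ, hfij]

open Classical in
lemma card_not_lists_div_le (h : n ≤ N) (h3 : N ≤ n + 3) (hkn : k ≤ n) (hn : 1 ≤ n) :
    (#{τ : Fin k → Fin N | ∀ e : Edge n k, ¬ Lists h τ e} : ℝ) / Fintype.card (Fin k → Fin N) ≤
      k * (k + 2) / N := by
  have hN : (0 : ℝ) < N := by exact_mod_cast (by omega : 0 < N)
  have hcard : #{τ : Fin k → Fin N | ∀ e : Edge n k, ¬ Lists h τ e} + n.descFactorial k = N ^ k := by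
    have h1 := card_related_mem (Lists.unique h (k := k)) (card_lists h) univ
    rw [card_univ, card_edge, ← Nat.descFactorial_eq_factorial_mul_choose] at h1
    have h2 := card_filter_add_card_filter_not (s := (univ : Finset (Fin k → Fin N)))
      (fun τ => ∃ e ∈ (univ : Finset (Edge n k)), Lists h τ e)
    rw [h1, card_univ, Fintype.card_fun, Fintype.card_fin, Fintype.card_fin] at h2
    rw [← h2, add_comm]
    simp
  have hcard' : (#{τ : Fin k → Fin N | ∀ e : Edge n k, ¬ Lists h τ e} : ℝ) =
      (N : ℝ) ^ k - n.descFactorial k := by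
    rw [eq_sub_iff_add_eq]; exact_mod_cast hcard
  have hdesc : ((n : ℝ) + 1 - k) ^ k ≤ n.descFactorial k := by
    have h1 := Nat.pow_sub_le_descFactorial n k
    have h2 : (((n + 1 - k) ^ k : ℕ) : ℝ) ≤ n.descFactorial k := by exact_mod_cast h1
    rw [Nat.cast_pow, Nat.cast_sub (by omega)] at h2
    exact_mod_cast h2
  have hkn' : (k : ℝ) ≤ n := by exact_mod_cast hkn
  have h3' : (N : ℝ) ≤ n + 3 := by exact_mod_cast h3
  have hber := one_add_mul_le_pow (a := ((n : ℝ) + 1 - k) / N - 1)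
    (by
      have : (0 : ℝ) ≤ ((n : ℝ) + 1 - k) / N := div_nonneg (by linarith) hN.le
      linarith) k
  rw [add_sub_cancel, div_pow] at hber
  have h4 : (k : ℝ) * ((k + 2) / N) ≥ - (k * (((n : ℝ) + 1 - k) / N - 1)) := by
    rw [← mul_neg]
    gcongr
    rw [neg_sub, sub_le_iff_le_add, ← add_div, le_div_iff₀ hN]
    linarith
  have hNk : (0 : ℝ) < (N : ℝ) ^ k := by positivity
  rw [hcard', Fintype.card_fun, Fintype.card_fin, Fintype.card_fin, Nat.cast_pow, sub_div,
    div_self hNk.ne', mul_div_assoc]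
  have h5 : ((n : ℝ) + 1 - k) ^ k / (N : ℝ) ^ k ≤ n.descFactorial k / (N : ℝ) ^ k := by gcongr
  linarith

open Classical in
/-- A set separating two sequences of tuples separates the edges they list. -/
lemma TupleSeparable.separable {M : ℕ} (h : n ≤ N) {ω ω' : Fin M → Fin k → Fin N}
    (hs : TupleSeparable ω ω') : Separable (sampled (Lists h) ω) (sampled (Lists h) ω') := by
  obtain ⟨A, hA, hB⟩ := hs
  refine ⟨univ.filter fun v => Fin.castLE h v ∈ A, fun e he => ?_, fun e he => ?_⟩
  · obtain ⟨t, ht⟩ := mem_sampled.1 he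
    obtain ⟨i, hi⟩ := hA t
    obtain ⟨v, hv, hvi⟩ := ht.2 i
    exact ⟨v, hv, by simpa [hvi] using hi⟩
  · obtain ⟨t, ht⟩ := mem_sampled.1 he
    obtain ⟨i, hi⟩ := hB t
    obtain ⟨v, hv, hvi⟩ := ht.2 i
    exact ⟨v, hv, by simpa [hvi] using hi⟩

lemma Separable.mono {S S' T T' : Finset (Edge n k)} (hS : S ⊆ S') (hT : T ⊆ T')
    (h : Separable S' T') : Separable S T := by
  obtain ⟨A, hA, hB⟩ := h
  exact ⟨A, fun e he => hA e (hS he), fun e he => hB e (hT he)⟩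

end Tuples

lemma separableFraction_ge {n k L M m : ℕ} (hk : 4 ≤ k) (hkn : k ≤ n) (h : n ≤ 4 * L)
    (h3 : 4 * L ≤ n + 3) (hS : overlapSum k L M ≤ 157 * (4 * L).choose (2 * L))
    (hM : (2 * M : ℝ) ≤ densityBound k * n) (hmM : m < M) :
    1 / 157 ≤ separableFraction k n m +
      2 * ((densityBound k * (k * (k + 2)) + densityBound k ^ 2 * k.factorial) / (M - m)) := by
  classical
  have hR := densityBound_pos hk
  have hN : (1 : ℝ) ≤ (4 * L : ℕ) := by exact_mod_cast (by omega : 1 ≤ 4 * L)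
  have hnN : (n : ℝ) ≤ (4 * L : ℕ) := by exact_mod_cast h
  have hsub : (0 : ℝ) < M - m := by
    have : (m : ℝ) < M := by exact_mod_cast hmM
    linarith
  have hβ : 0 < Fintype.card (Fin k → Fin (4 * L)) := by
    rw [Fintype.card_fun, Fintype.card_fin]
    exact pow_pos (by omega) _
  set Ω : ℝ := (Fintype.card (Fin M → Fin k → Fin (4 * L)) : ℝ) with hΩ
  have hΩ0 : 0 < Ω := by
    rw [hΩ, Fintype.card_fun]
    exact_mod_cast pow_pos hβ _
  have h1 := card_tupleSeparable_ge (M := M) hk (by omega : 1 ≤ L) (Fintype.card_fin (4 * L)) hS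
  have h2 := card_sampled_pair_le (Lists.unique h (k := k)) (card_lists h) M m Separable
    fun _ _ _ _ hS hT => Separable.mono hS hT
  have h3' := card_sampled_lt_le (Lists.unique h (k := k)) (card_lists h) hβ M m
  have h4 := card_not_lists_div_le (k := k) h h3 hkn (by omega)
  rw [card_edge] at h2
  set ε : ℝ := (#{ω : Fin M → Fin k → Fin (4 * L) | #(sampled (Lists h) ω) < m} : ℝ) with hε
  have h5 : (#{p : (Fin M → Fin k → Fin (4 * L)) × (Fin M → Fin k → Fin (4 * L)) |
      TupleSeparable p.1 p.2} : ℝ) ≤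
      #{p : (Fin M → Fin k → Fin (4 * L)) × (Fin M → Fin k → Fin (4 * L)) |
        Separable (sampled (Lists h) p.1) (sampled (Lists h) p.2)} := by
    gcongr with p hp
    exact TupleSeparable.separable h
  have hM' : (M : ℝ) ≤ densityBound k * (4 * L : ℕ) := by
    have : densityBound k * n ≤ densityBound k * (4 * L : ℕ) := by gcongr
    have : (0 : ℝ) ≤ M := by positivity
    linarith
  have h6 : (M : ℝ) * ((#{τ : Fin k → Fin (4 * L) | ∀ e : Edge n k, ¬ Lists h τ e} : ℝ) /
      Fintype.card (Fin k → Fin (4 * L))) ≤ densityBound k * (k * (k + 2)) := by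
    calc _ ≤ densityBound k * (4 * L : ℕ) * (k * (k + 2) / (4 * L : ℕ)) := by gcongr
      _ = _ := by field_simp
  have h7 : (M : ℝ) ^ 2 * ((k.factorial : ℝ) / Fintype.card (Fin k → Fin (4 * L))) ≤
      densityBound k ^ 2 * k.factorial := by
    have hpow : ((4 * L : ℕ) : ℝ) ^ 2 ≤ Fintype.card (Fin k → Fin (4 * L)) := by
      rw [Fintype.card_fun, Fintype.card_fin, Fintype.card_fin, Nat.cast_pow]
      exact pow_le_pow_right₀ hN (by omega)
    calc _ ≤ (densityBound k * (4 * L : ℕ)) ^ 2 * ((k.factorial : ℝ) / ((4 * L : ℕ) : ℝ) ^ 2) := by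
          gcongr
      _ = _ := by field_simp
  set c : ℝ := densityBound k * (k * (k + 2)) + densityBound k ^ 2 * k.factorial with hc
  have h8 : ε ≤ Ω * (c / (M - m)) := by
    rw [mul_div_assoc', le_div_iff₀ hsub]
    refine h3'.trans ?_
    gcongr
    exact add_le_add h6 h7
  have h9 : Ω ^ 2 ≤ 157 * (Ω ^ 2 * separableFraction k n m + 2 * Ω * (Ω * (c / (M - m)))) := by
    refine h1.trans ?_
    gcongr
    refine h5.trans (h2.trans ?_)
    unfold separableFraction
    gcongr
  have h10 : Ω ^ 2 * 1 ≤ Ω ^ 2 * (157 * (separableFraction k n m + 2 * (c / (M - m)))) := by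
    linarith
  have := le_of_mul_le_mul_left h10 (by positivity)
  linarith

lemma eventually_separableFraction_gt {k : ℕ} (hk : 4 ≤ k) {r : ℝ} (hr0 : 0 ≤ r)
    (hr : 2 * r < densityBound k) :
    ∀ᶠ n : ℕ in atTop, 1 / 314 < separableFraction k n ⌊r * n⌋₊ := by
  have hR := densityBound_pos hk
  set R := densityBound k with hRdef
  set c : ℝ := R * (k * (k + 2)) + R ^ 2 * k.factorial with hc
  have hc0 : 0 < c := by positivity
  have hgap : Tendsto (fun n : ℕ => (R / 2 - r) * (n : ℝ)) atTop atTop :=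
    tendsto_natCast_atTop_atTop.const_mul_atTop (by linarith)
  have hL : Tendsto (fun n : ℕ => (n + 3) / 4) atTop atTop :=
    tendsto_atTop_mono (fun n => by omega) (Nat.tendsto_div_const_atTop (by norm_num : (4 : ℕ) ≠ 0))
  filter_upwards [hL.eventually (eventually_overlapSum_le hk), eventually_ge_atTop k,
    hgap.eventually_ge_atTop (1 + 1000 * c + 1)] with n hsum hkn hn
  set L := (n + 3) / 4 with hLdef
  set M := ⌊R / 2 * n⌋₊ with hM
  set m := ⌊r * n⌋₊ with hm
  have h1 : n ≤ 4 * L := by omega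
  have h2 : 4 * L ≤ n + 3 := by omega
  have hn0 : (0 : ℝ) ≤ n := by positivity
  have hMle : (M : ℝ) ≤ R / 2 * n := Nat.floor_le (by positivity)
  have hMgt : R / 2 * n < M + 1 := Nat.lt_floor_add_one _
  have hmle : (m : ℝ) ≤ r * n := Nat.floor_le (by positivity)
  have hdiff : 1000 * c < M - m := by nlinarith
  have hmM : m < M := by
    have : (m : ℝ) < M := by linarith
    exact_mod_cast this
  have hM2 : (2 * M : ℝ) ≤ R * n := by linarith
  have hM4 : (2 * M : ℝ) ≤ R * (4 * L) := by
    have : (n : ℝ) ≤ 4 * L := by exact_mod_cast h1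
    exact hM2.trans (by gcongr)
  have h := separableFraction_ge hk hkn h1 h2 (hsum M hM4) hM2 hmM
  have hsmall : c / (M - m) < 1 / 1000 := by
    rw [div_lt_div_iff₀ (by linarith) (by norm_num)]
    linarith
  norm_num at h hsmall ⊢
  linarith

end DisjointCovers

theorem theorem4 (k : ℕ) (hk : 3 ≤ k) :
    (∀ r : ℝ, 2 ^ (k - 1) * Real.log 2 < r →
      Tendsto
        (fun n : ℕ => (DisjointCovers.randomPair k n ⌊r * n⌋₊).real
          {H | ¬ DisjointCovers.AdmitDisjointCovers H.1 H.2})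
        atTop (𝓝 1)) ∧
    (∃ C : ℝ, 0 < C ∧ ∀ r : ℝ, 0 ≤ r →
      r < 2 ^ (k - 1) * Real.log 2 - (k + 1) * Real.log 2 - 1 →
      ∀ᶠ n : ℕ in atTop,
        C < (DisjointCovers.randomPair k n ⌊r * n⌋₊).real
          {H | DisjointCovers.AdmitDisjointCovers H.1 H.2}) := by
  refine ⟨fun r hr => ?_, 1 / 314, by norm_num, fun r hr0 hr => ?_⟩
  · have h := (DisjointCovers.tendsto_separableFraction_zero (by omega) hr).const_sub 1
    rw [sub_zero] at h
    refine h.congr' ?_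
    filter_upwards [DisjointCovers.eventually_floor_le_choose (k := k) (by omega) r] with n hn
    exact (DisjointCovers.randomPair_real_not_admitDisjointCovers hn).symm
  · have hk4 : 4 ≤ k := by
      -- For `k = 3` the bound on `r` is `-1`.
      by_contra h
      obtain rfl : k = 3 := by omega
      norm_num at hr
      linarith
    simp only [DisjointCovers.randomPair_real_admitDisjointCovers]
    exact DisjointCovers.eventually_separableFraction_gt hk4 hr0
      (by rw [DisjointCovers.densityBound]; linarith)
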